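/- There exist numerical constants $c_1,c_2>0$ such that the following holds. Let $m_1,m_2,n\ge 1$, $d=m_1+m_2$, $A_0\in\mathbb R^{m_1\times m_2}$, $\sigma\in\mathbb R$, and let $X_1,\dots,X_n$ be i.i.d. random matrices with distribution $\Pi$ on $\mathcal X=\{e_j(m_1)e_k(m_2)^T:1\le j\le m_1,\,1\le k\le m_2\}$, where $e_l(m)$ are the canonical basis vectors of $\mathbb R^m$. Put $\pi_{jk}=\Pi(\{e_j(m_1)e_k(m_2)^T\})$, $R_j=\sum_k\pi_{jk}$, $C_k=\sum_j\pi_{jk}$, and assume that for some constants $L\ge1$ and $\mu\ge1$, $$\max_{j,k}(C_k,R_j)\le \frac{L}{\min(m_1,m_2)},\qquad \pi_{jk}\ge\frac1{\mu m_1m_2}\ \text{ for all } j,k .$$ Let $Y_i=\mathrm{tr}(X_i^TA_0)+\sigma\xi_i$, $i=1,\dots,n$, where the $\xi_i$ are independent real random variables with $\mathbb E\xi_i=0$, $\mathbb E\xi_i^2=1$. Let $\sigma_1(A)\ge\sigma_2(A)\ge\dots$ be the singular values of $A$, and write $\|A\|=\sigma_1(A)$, $\|A\|_q=\big(\sum_{j\le\min(m_1,m_2)}\sigma_j(A)^q\big)^{1/q}$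 for $q=1,2$ (so $\|\cdot\|_1$ is the nuclear and $\|\cdot\|_2$ the Frobenius norm), and $\|A\|_\infty=\max_{i,j}|A_{ij}|$. Let $\Sigma=\frac{\sigma}{n}\sum_{i=1}^n\xi_iX_i$ and $\Sigma_R=\frac1n\sum_{i=1}^n\varepsilon_iX_i$, where $(\varepsilon_i)$ is an i.i.d. Rademacher sequence independent of $(X_i)$. Assume that $\|A_0\|_\infty\le \mathbf a$ for a constant $\mathbf a$. Then there is an event of probability at least $1-\frac2d$ on which, for every $\lambda>3\|\Sigma\|$ and every minimizer $$\hat A\in\operatorname*{arg\,min}_{\|A\|_\infty\le\mathbf a}\Big\{\frac1n\sum_{i=1}^n\big(Y_i-\mathrm{tr}(X_i^TA)\big)^2+\lambda\|A\|_1\Big\},$$ one has $$\frac{\|\hat A-A_0\|_2^2}{m_1m_2}\le\max\Big\{c_1\mu^2m_1m_2\,\mathrm{rank}(A_0)\big(\lambda^2+\mathbf a^2(\mathbb E\|\Sigma_R\|)^2\big),\ c_2\mathbf a^2\mu\sqrt{\tfrac{\log d}{n}}\Big\}.$$ -/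

import Mathlib

open MeasureTheory ProbabilityTheory
open scoped ENNReal Matrix

namespace MatrixCompletion

/-- Matrices carry the product (equivalently, Borel) sigma-algebra of their entries. -/
instance instMeasurableSpaceMatrix {ι κ : Type*} : MeasurableSpace (Matrix ι κ ℝ) :=
  inferInstanceAs (MeasurableSpace (ι → κ → ℝ))

section MatrixNotions

variable {m₁ m₂ : ℕ}

/-- The singular values of `A` in decreasing order, indexed from `0` and extended by zero. -/
noncomputable def singularValue (A : Matrix (Fin m₁) (Fin m₂) ℝ) (j : ℕ) : ℝ :=
  (Matrix.toEuclideanLin A).singularValues j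

/-- The Schatten-`q` (quasi-)norm. -/
noncomputable def schattenNorm (q : ℝ) (A : Matrix (Fin m₁) (Fin m₂) ℝ) : ℝ :=
  (∑ j ∈ Finset.range (min m₁ m₂), singularValue A j ^ q) ^ (1 / q)

/-- The operator norm: the largest singular value. -/
noncomputable def opNorm (A : Matrix (Fin m₁) (Fin m₂) ℝ) : ℝ :=
  singularValue A 0

/-- The largest absolute value of an entry. -/
noncomputable def maxNorm (A : Matrix (Fin m₁) (Fin m₂) ℝ) : ℝ :=
  ⨆ p : Fin m₁ × Fin m₂, |A p.1 p.2|

/-- The trace scalar product `tr (Aᵀ B)`. -/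
def traceInner (A B : Matrix (Fin m₁) (Fin m₂) ℝ) : ℝ :=
  (Aᵀ * B).trace

/-- The set of matrices `e_j e_kᵀ`. -/
def basisMatrices (m₁ m₂ : ℕ) : Set (Matrix (Fin m₁) (Fin m₂) ℝ) :=
  {B | ∃ (j : Fin m₁) (k : Fin m₂), B = Matrix.single j k (1 : ℝ)}

end MatrixNotions

section Sampling

variable {m₁ m₂ : ℕ}

/-- The probability `π_{jk}` of observing the entry `(j, k)`. -/
noncomputable def entryProb (Q : Measure (Matrix (Fin m₁) (Fin m₂) ℝ))
    (j : Fin m₁) (k : Fin m₂) : ℝ :=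
  Q.real {Matrix.single j k (1 : ℝ)}

/-- The probability `R_j` of observing an entry of the row `j`. -/
noncomputable def rowProb (Q : Measure (Matrix (Fin m₁) (Fin m₂) ℝ)) (j : Fin m₁) : ℝ :=
  ∑ k, entryProb Q j k

/-- The probability `C_k` of observing an entry of the column `k`. -/
noncomputable def colProb (Q : Measure (Matrix (Fin m₁) (Fin m₂) ℝ)) (k : Fin m₂) : ℝ :=
  ∑ j, entryProb Q j k

/-- `L ≥ 1`, and no row and no column is sampled with probability larger than `L / min(m₁, m₂)`. -/
def MarginalBound (Q : Measure (Matrix (Fin m₁) (Fin m₂) ℝ)) (L : ℝ) : Prop :=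
  1 ≤ L ∧ (∀ j, rowProb Q j ≤ L / (min m₁ m₂ : ℕ)) ∧ (∀ k, colProb Q k ≤ L / (min m₁ m₂ : ℕ))

/-- `μ ≥ 1`, and every entry is sampled with probability at least `1 / (μ m₁ m₂)`. -/
def EntryLowerBound (Q : Measure (Matrix (Fin m₁) (Fin m₂) ℝ)) (μ : ℝ) : Prop :=
  1 ≤ μ ∧ ∀ j k, (μ * m₁ * m₂)⁻¹ ≤ entryProb Q j k

end Sampling

section Regression

variable {m₁ m₂ n : ℕ}

/-- The response `Y_i = tr (X_iᵀ A₀) + σ ξ_i`, for given design matrices and noise values. -/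
noncomputable def response (A₀ : Matrix (Fin m₁) (Fin m₂) ℝ) (σ : ℝ)
    (x : Fin n → Matrix (Fin m₁) (Fin m₂) ℝ) (z : Fin n → ℝ) (i : Fin n) : ℝ :=
  traceInner (x i) A₀ + σ * z i

/-- The penalized least squares criterion. -/
noncomputable def criterion (lam : ℝ) (x : Fin n → Matrix (Fin m₁) (Fin m₂) ℝ)
    (y : Fin n → ℝ) (A : Matrix (Fin m₁) (Fin m₂) ℝ) : ℝ :=
  1 / (n : ℝ) * ∑ i, (y i - traceInner (x i) A) ^ 2 + lam * schattenNorm 1 A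

/-- `A'` minimizes the criterion among the matrices with entries bounded by `a`. -/
def IsEstimator (a lam : ℝ) (x : Fin n → Matrix (Fin m₁) (Fin m₂) ℝ) (y : Fin n → ℝ)
    (A' : Matrix (Fin m₁) (Fin m₂) ℝ) : Prop :=
  maxNorm A' ≤ a ∧
    ∀ A : Matrix (Fin m₁) (Fin m₂) ℝ, maxNorm A ≤ a → criterion lam x y A' ≤ criterion lam x y A

/-- The matrix `Σ_R = (1/n) ∑ w_i x_i`, for given signs `w_i`. -/
noncomputable def rademacherMatrix (w : Fin n → ℝ) (x : Fin n → Matrix (Fin m₁) (Fin m₂) ℝ) :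
    Matrix (Fin m₁) (Fin m₂) ℝ :=
  (1 / (n : ℝ)) • ∑ i, w i • x i

/-- The noise matrix `Σ = (σ/n) ∑ ξ_i X_i`. -/
noncomputable def noiseMatrix (σ : ℝ) (z : Fin n → ℝ)
    (x : Fin n → Matrix (Fin m₁) (Fin m₂) ℝ) : Matrix (Fin m₁) (Fin m₂) ℝ :=
  (σ / (n : ℝ)) • ∑ i, z i • x i

/-- The Rademacher distribution, uniform on `{-1, 1}`. -/
noncomputable def rademacher : Measure ℝ :=
  (1 / 2 : ℝ≥0∞) • Measure.dirac 1 + (1 / 2 : ℝ≥0∞) • Measure.dirac (-1)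

instance isProbabilityMeasure_rademacher : IsProbabilityMeasure rademacher :=
  ⟨by simp [rademacher, ENNReal.inv_two_add_inv_two]⟩

/-- The expectation `𝔼 ‖Σ_R‖`, where `Σ_R = (1/n) ∑ ε_i X_i` and `ε_1, …, ε_n` are i.i.d.
Rademacher variables, independent of the design; they live on the second factor of the
product of the underlying probability space with `ℝⁿ`. -/
noncomputable def expectedRademacherNorm {Ω : Type*} [MeasurableSpace Ω] (P : Measure Ω)
    (X : Fin n → Ω → Matrix (Fin m₁) (Fin m₂) ℝ) : ℝ :=
  ∫ p, opNorm (rademacherMatrix p.2 (fun i => X i p.1))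
    ∂(P.prod (Measure.pi (fun _ : Fin n => rademacher)))

end Regression

end MatrixCompletion

/-!
The proof compares the empirical with the population quadratic form of the error
`Δ = A' - A₀`, whose entries are bounded by `2a`.

On the one hand, the minimality of `A'` and the trace duality of the operator and the nuclear norm
bound the empirical form `(1/n) ∑ ⟨X_i, Δ⟩²` (`mean_sq_traceInner_le`). By the decomposability of
the nuclear norm at `A₀` (`LinearMap.exists_nuclear_decomposition`), and since `λ` dominates the noise,
the bound is of order `λ √(rank A₀) ‖Δ‖₂`, and `‖Δ‖₁` is at most of order `√(rank A₀) ‖Δ‖₂`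
(`estimator_error_bounds`).

On the other hand, on an event that does not depend on `λ` and `A'`, the empirical form is at least
half of the population form `‖Δ‖²_{L₂(Π)}`, unless the latter is below `4a²ν`, where `ν` is the
maximum of `6 √(log d / n)` and a multiple of `μ m₁ m₂ rank(A₀) (𝔼 ‖Σ_R‖)²`. Because this threshold
is deterministic, it suffices by homogeneity to consider matrices at the level `ν` exactly
(`half_weightedSq_le`), and no peeling over levels is needed. At that level the largest deficit of
the empirical form has mean at most `ν / 4`, by symmetrization, the contraction principle and
trace duality, and exceeds its mean by `ν / 4` with probability at most `1 / d`, by a bounded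
difference inequality (`productMean_ite_exists_le_exp`, `productMean_normalizedCone_le`).

If the population form is below the threshold, the claim follows from `π_{jk} ≥ 1 / (μ m₁ m₂)`;
otherwise the two bounds combine to one on `‖Δ‖₂`. As the design takes finitely many values, all
expectations over it are finite sums (`productMean`), which avoids questions of measurability of
suprema.
-/

/-! ### Duality and decomposability of the nuclear norm -/

namespace LinearMap

open Module

variable {E F : Type*} [NormedAddCommGroup E] [InnerProductSpace ℝ E] [FiniteDimensional ℝ E]
  [NormedAddCommGroup F] [InnerProductSpace ℝ F] [FiniteDimensional ℝ F]

/-- The Hilbert–Schmidt inner product `tr (Wᵀ T)` of two linear maps. -/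
noncomputable def hsInner (W T : E →ₗ[ℝ] F) : ℝ :=
  LinearMap.trace ℝ E (adjoint W ∘ₗ T)

/-- The nuclear norm, the sum of all singular values. -/
noncomputable def nuclear (T : E →ₗ[ℝ] F) : ℝ :=
  ∑ i : Fin (finrank ℝ E), T.singularValues i

theorem hsInner_eq_sum {ι : Type*} [Fintype ι] (b : OrthonormalBasis ι ℝ E) (W T : E →ₗ[ℝ] F) :
    hsInner W T = ∑ i, inner ℝ (W (b i)) (T (b i)) := by
  rw [hsInner, trace_eq_sum_inner _ b]
  simp [adjoint_inner_right]

theorem hsInner_comm (W T : E →ₗ[ℝ] F) : hsInner W T = hsInner T W := by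
  simp_rw [hsInner_eq_sum (stdOrthonormalBasis ℝ E)]
  exact Finset.sum_congr rfl fun i _ => real_inner_comm _ _

theorem hsInner_add_right (W S T : E →ₗ[ℝ] F) :
    hsInner W (S + T) = hsInner W S + hsInner W T := by
  simp [hsInner, comp_add]

theorem hsInner_add_left (W S T : E →ₗ[ℝ] F) :
    hsInner (S + T) W = hsInner S W + hsInner T W := by
  simp [hsInner, add_comp]

theorem hsInner_smul_right (W T : E →ₗ[ℝ] F) (c : ℝ) :
    hsInner W (c • T) = c * hsInner W T := by
  simp [hsInner, comp_smul]

theorem hsInner_self_nonneg (T : E →ₗ[ℝ] F) : 0 ≤ hsInner T T := by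
  rw [hsInner_eq_sum (stdOrthonormalBasis ℝ E)]
  exact Finset.sum_nonneg fun i _ => real_inner_self_nonneg

theorem hsInner_comp_left_symmetric {P : F →ₗ[ℝ] F} (hP : P.IsSymmetric) (W T : E →ₗ[ℝ] F) :
    hsInner W (P ∘ₗ T) = hsInner (P ∘ₗ W) T := by
  simp_rw [hsInner_eq_sum (stdOrthonormalBasis ℝ E)]
  exact Finset.sum_congr rfl fun i _ => (hP _ _).symm

theorem hsInner_comp_right_symmetric {Q : E →ₗ[ℝ] E} (hQ : Q.IsSymmetric) (W T : E →ₗ[ℝ] F) :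
    hsInner W (T ∘ₗ Q) = hsInner (W ∘ₗ Q) T := by
  have hQ' : adjoint Q = Q := isSymmetric_iff_isSelfAdjoint Q |>.1 hQ
  rw [hsInner, hsInner, adjoint_comp, hQ', ← comp_assoc, trace_comp_comm', comp_assoc]

/-- The orthonormal basis of right singular vectors of `T`. -/
noncomputable def rightSingularBasis (T : E →ₗ[ℝ] F) :
    OrthonormalBasis (Fin (finrank ℝ E)) ℝ E :=
  T.isSymmetric_adjoint_comp_self.eigenvectorBasis rfl

theorem adjoint_apply_rightSingularBasis (T : E →ₗ[ℝ] F) (i : Fin (finrank ℝ E)) :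
    adjoint T (T (T.rightSingularBasis i)) =
      T.singularValues i ^ 2 • T.rightSingularBasis i := by
  have h := T.isSymmetric_adjoint_comp_self.apply_eigenvectorBasis rfl i
  rw [T.sq_singularValues_fin rfl]
  exact h

theorem norm_sq_apply_eq_sum (T : E →ₗ[ℝ] F) (x : E) :
    ‖T x‖ ^ 2 = ∑ i : Fin (finrank ℝ E),
      T.singularValues i ^ 2 * inner ℝ (T.rightSingularBasis i) x ^ 2 := by
  rw [← real_inner_self_eq_norm_sq, ← adjoint_inner_right,
    ← T.rightSingularBasis.sum_inner_mul_inner]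
  refine Finset.sum_congr rfl fun i _ => ?_
  rw [adjoint_inner_right, ← adjoint_inner_left, adjoint_apply_rightSingularBasis,
    real_inner_smul_left, real_inner_comm]
  ring

theorem norm_apply_rightSingularBasis (T : E →ₗ[ℝ] F) (i : Fin (finrank ℝ E)) :
    ‖T (T.rightSingularBasis i)‖ = T.singularValues i := by
  rw [← sq_eq_sq₀ (norm_nonneg _) (T.singularValues_nonneg i), norm_sq_apply_eq_sum]
  simp [orthonormal_iff_ite.1 T.rightSingularBasis.orthonormal, ite_pow]

theorem norm_apply_le_singularValues_zero (T : E →ₗ[ℝ] F) (x : E) :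
    ‖T x‖ ≤ T.singularValues 0 * ‖x‖ := by
  have h0 := T.singularValues_nonneg 0
  refine le_of_sq_le_sq ?_ (by positivity)
  rw [norm_sq_apply_eq_sum, mul_pow, ← T.rightSingularBasis.sum_sq_inner_right x,
    Finset.mul_sum]
  refine Finset.sum_le_sum fun i _ => ?_
  have h := T.singularValues_antitone (Nat.zero_le (i : ℕ))
  have := T.singularValues_nonneg i
  gcongr

theorem hsInner_self_eq_sum (T : E →ₗ[ℝ] F) :
    hsInner T T = ∑ i : Fin (finrank ℝ E), T.singularValues i ^ 2 := by
  simp [hsInner_eq_sum T.rightSingularBasis, norm_apply_rightSingularBasis]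

theorem hsInner_le_mul_nuclear {W T : E →ₗ[ℝ] F} {c : ℝ} (hW : ∀ x, ‖W x‖ ≤ c * ‖x‖) :
    hsInner W T ≤ c * T.nuclear := by
  rw [hsInner_eq_sum T.rightSingularBasis, nuclear, Finset.mul_sum]
  refine Finset.sum_le_sum fun i _ => (real_inner_le_norm _ _).trans ?_
  rw [norm_apply_rightSingularBasis]
  have := hW (T.rightSingularBasis i)
  rw [T.rightSingularBasis.orthonormal.1 i, mul_one] at this
  exact mul_le_mul_of_nonneg_right this (T.singularValues_nonneg i)

/-- The nuclear norm is attained as the pairing with a contraction, the partial isometry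
of the polar decomposition. -/
theorem exists_hsInner_eq_nuclear (T : E →ₗ[ℝ] F) :
    ∃ W : E →ₗ[ℝ] F, (∀ x, ‖W x‖ ≤ ‖x‖) ∧ hsInner W T = T.nuclear := by
  set b := T.rightSingularBasis
  -- `D` divides the `i`-th coordinate by the `i`-th singular value, and kills it if that is zero
  let D : E →ₗ[ℝ] E := b.toBasis.constr ℝ fun i => (T.singularValues i)⁻¹ • b i
  have hDb : ∀ i, D (b i) = (T.singularValues i)⁻¹ • b i := fun i => by
    have h := b.toBasis.constr_basis ℝ (fun i => (T.singularValues i)⁻¹ • b i) i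
    rwa [b.coe_toBasis] at h
  have hDx : ∀ x i, inner ℝ (b i) (D x) = (T.singularValues i)⁻¹ * inner ℝ (b i) x := by
    intro x i
    conv_lhs => rw [← b.sum_repr' x]
    simp [inner_sum, hDb, inner_smul_right, orthonormal_iff_ite.1 b.orthonormal, mul_comm]
  refine ⟨T ∘ₗ D, fun x => ?_, ?_⟩
  · refine le_of_sq_le_sq ?_ (norm_nonneg _)
    rw [comp_apply, norm_sq_apply_eq_sum, ← b.sum_sq_inner_right x]
    refine Finset.sum_le_sum fun i _ => ?_
    rw [hDx]
    rcases eq_or_ne (T.singularValues i) 0 with h | h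
    · simpa [h] using sq_nonneg (inner ℝ (b i) x)
    · rw [← mul_pow, mul_inv_cancel_left₀ h]
  · rw [hsInner_eq_sum b, nuclear]
    refine Finset.sum_congr rfl fun i _ => ?_
    rw [comp_apply, hDb, map_smul, real_inner_smul_left, real_inner_self_eq_norm_sq,
      norm_apply_rightSingularBasis]
    rcases eq_or_ne (T.singularValues i) 0 with h | h
    · simp [h]
    · field_simp

theorem nuclear_nonneg (T : E →ₗ[ℝ] F) : 0 ≤ T.nuclear :=
  Finset.sum_nonneg fun i _ => T.singularValues_nonneg i

theorem hsInner_le_nuclear {W : E →ₗ[ℝ] F} (hW : ∀ x, ‖W x‖ ≤ ‖x‖) (T : E →ₗ[ℝ] F) :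
    hsInner W T ≤ T.nuclear := by
  simpa using hsInner_le_mul_nuclear (T := T) (c := 1) (by simpa using hW)

theorem nuclear_add_le (S T : E →ₗ[ℝ] F) : (S + T).nuclear ≤ S.nuclear + T.nuclear := by
  obtain ⟨W, hW, h⟩ := (S + T).exists_hsInner_eq_nuclear
  rw [← h, hsInner_add_right]
  exact add_le_add (hsInner_le_nuclear hW S) (hsInner_le_nuclear hW T)

theorem nuclear_smul_le {c : ℝ} (hc : 0 ≤ c) (T : E →ₗ[ℝ] F) :
    (c • T).nuclear ≤ c * T.nuclear := by
  obtain ⟨W, hW, h⟩ := (c • T).exists_hsInner_eq_nuclear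
  rw [← h, hsInner_smul_right]
  exact mul_le_mul_of_nonneg_left (hsInner_le_nuclear hW T) hc

theorem nuclear_le_sqrt_finrank_range_mul (T : E →ₗ[ℝ] F) :
    T.nuclear ≤ √(finrank ℝ T.range) * √(hsInner T T) := by
  have hsupp : ∀ f : ℝ → ℝ, f 0 = 0 → ∑ i : Fin (finrank ℝ E), f (T.singularValues i) =
      ∑ i ∈ T.singularValues.support, f (T.singularValues i) := by
    intro f hf
    rw [Fin.sum_univ_eq_sum_range (fun i => f (T.singularValues i))]
    refine (Finset.sum_subset (fun i hi => ?_) fun i _ hi => ?_).symm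
    · rw [Finset.mem_range]
      by_contra! h
      exact Finsupp.mem_support_iff.1 hi (T.singularValues_of_finrank_le h)
    · rw [Finsupp.notMem_support_iff.1 hi, hf]
  rw [hsInner_self_eq_sum, nuclear, hsupp (fun x => x) rfl, hsupp (· ^ 2) (by simp),
    ← T.card_support_singularValues, ← Real.sqrt_mul (by positivity)]
  exact Real.le_sqrt_of_sq_le sq_sum_le_card_mul_sum_sq

/-- Decomposability of the nuclear norm at `S`: a perturbation `T` splits into a part `D` of rank
at most twice that of `S` and a rest, whose row and column spaces are orthogonal to those of `S`, so
that its nuclear norm adds to that of `S`. -/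
theorem exists_nuclear_decomposition (S T : E →ₗ[ℝ] F) :
    ∃ D : E →ₗ[ℝ] F, D.nuclear ≤ √(2 * finrank ℝ S.range) * √(hsInner T T) ∧
      S.nuclear + (T - D).nuclear ≤ (S + T).nuclear + D.nuclear := by
  let P : F →ₗ[ℝ] F := S.range.starProjection
  let P' : F →ₗ[ℝ] F := S.rangeᗮ.starProjection
  let Q : E →ₗ[ℝ] E := S.kerᗮ.starProjection
  let Q' : E →ₗ[ℝ] E := S.ker.starProjection
  have hP : P.IsSymmetric := S.range.starProjection_isSymmetric
  have hP' : P'.IsSymmetric := S.rangeᗮ.starProjection_isSymmetric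
  have hQ : Q.IsSymmetric := S.kerᗮ.starProjection_isSymmetric
  have hQ' : Q'.IsSymmetric := S.ker.starProjection_isSymmetric
  have hPadd : ∀ y, P y + P' y = y := fun y => by simp [P, P']
  have hQadd : ∀ x, Q x + Q' x = x := fun x => by simp [Q, Q']
  have hP'P' : ∀ y, P' (P' y) = P' y := fun y =>
    Submodule.starProjection_eq_self_iff.2 (Submodule.starProjection_apply_mem _ y)
  have hPP' : ∀ y, P (P' y) = 0 := fun y => by
    have := hPadd (P' y); rwa [hP'P', add_eq_right] at this
  have hPP : ∀ y, P (P y) = P y := fun y =>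
    Submodule.starProjection_eq_self_iff.2 (Submodule.starProjection_apply_mem _ y)
  have hP'P : ∀ y, P' (P y) = 0 := fun y => by
    have := hPadd (P y); rwa [hPP, add_eq_left] at this
  have hQ'Q' : ∀ x, Q' (Q' x) = Q' x := fun x =>
    Submodule.starProjection_eq_self_iff.2 (Submodule.starProjection_apply_mem _ x)
  have hPS : ∀ x, P (S x) = S x := fun x =>
    Submodule.starProjection_eq_self_iff.2 (mem_range_self S x)
  have hP'S : ∀ x, P' (S x) = 0 := fun x => by
    have := hPadd (S x); rwa [hPS, add_eq_left] at this
  have hSQ' : ∀ x, S (Q' x) = 0 := fun x => Submodule.starProjection_apply_mem S.ker x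
  have hSQ : ∀ x, S (Q x) = S x := fun x => by
    have := congrArg S (hQadd x); rwa [map_add, hSQ', add_zero] at this
  have hpyP : ∀ y, ‖y‖ ^ 2 = ‖P y‖ ^ 2 + ‖P' y‖ ^ 2 := fun y =>
    Submodule.norm_sq_eq_add_norm_sq_starProjection y S.range
  have hpyQ : ∀ x, ‖x‖ ^ 2 = ‖Q x‖ ^ 2 + ‖Q' x‖ ^ 2 := fun x => by
    rw [add_comm]
    exact Submodule.norm_sq_eq_add_norm_sq_starProjection x S.ker
  -- moving the projections from one side of the pairing to the other
  have hmove : ∀ {p : F →ₗ[ℝ] F} {q : E →ₗ[ℝ] E}, p.IsSymmetric → q.IsSymmetric →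
      ∀ V T : E →ₗ[ℝ] F, hsInner (p ∘ₗ V ∘ₗ q) T = hsInner V (p ∘ₗ T ∘ₗ q) := by
    intro p q hp hq V T
    rw [← hsInner_comp_left_symmetric hp, ← hsInner_comp_right_symmetric hq, comp_assoc]
  let R : E →ₗ[ℝ] F := P' ∘ₗ T ∘ₗ Q'
  refine ⟨T - R, ?_, ?_⟩
  · refine (nuclear_le_sqrt_finrank_range_mul _).trans ?_
    have hrank : finrank ℝ (T - R).range ≤ 2 * finrank ℝ S.range := by
      have hle : (T - R).range ≤ S.range ⊔ S.kerᗮ.map (P' ∘ₗ T) := by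
        rintro _ ⟨x, rfl⟩
        have hx : (T - R) x = P (T x) + (P' ∘ₗ T) (Q x) := by
          conv_lhs => rw [sub_apply, ← hPadd (T x)]
          have := congrArg (fun y => P' (T y)) (hQadd x)
          simp only [map_add] at this
          simp only [R, comp_apply, ← this]
          abel
        rw [hx]
        exact Submodule.add_mem_sup (Submodule.starProjection_apply_mem _ _)
          (Submodule.mem_map_of_mem (Submodule.starProjection_apply_mem _ _))
      have h1 := Submodule.finrank_mono hle
      have h2 := Submodule.finrank_add_le_finrank_add_finrank S.range (S.kerᗮ.map (P' ∘ₗ T))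
      have h3 := Submodule.finrank_map_le (P' ∘ₗ T) S.kerᗮ
      have h4 := S.ker.finrank_add_finrank_orthogonal
      have h5 := S.finrank_range_add_finrank_ker
      omega
    have hsq : hsInner (T - R) (T - R) ≤ hsInner T T := by
      have h0 : hsInner R (T - R) = 0 := by
        rw [hmove hP' hQ']
        have : P' ∘ₗ (T - R) ∘ₗ Q' = 0 := by
          ext x; simp [R, hP'P', hQ'Q']
        rw [this]
        simp [hsInner]
      have h1 : hsInner T T = hsInner (T - R) (T - R) + hsInner R R := by
        have : T = (T - R) + R := by abel
        conv_lhs => rw [this]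
        rw [hsInner_add_left, hsInner_add_right, hsInner_add_right, hsInner_comm (T - R) R, h0]
        ring
      have := hsInner_self_nonneg R
      linarith
    gcongr
    exact_mod_cast hrank
  · obtain ⟨V, hV, hVS⟩ := S.exists_hsInner_eq_nuclear
    obtain ⟨V', hV', hVR⟩ := R.exists_hsInner_eq_nuclear
    let W : E →ₗ[ℝ] F := P ∘ₗ V ∘ₗ Q + P' ∘ₗ V' ∘ₗ Q'
    have hW : ∀ x, ‖W x‖ ≤ ‖x‖ := by
      intro x
      refine le_of_sq_le_sq ?_ (norm_nonneg _)
      have h1 : P (W x) = P (V (Q x)) := by simp [W, hPP, hPP']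
      have h2 : P' (W x) = P' (V' (Q' x)) := by simp [W, hP'P, hP'P']
      have h3 := hpyP (V (Q x))
      have h4 := hpyP (V' (Q' x))
      have h5 := pow_le_pow_left₀ (norm_nonneg _) (hV (Q x)) 2
      have h6 := pow_le_pow_left₀ (norm_nonneg _) (hV' (Q' x)) 2
      rw [hpyP (W x), h1, h2, hpyQ x]
      nlinarith [sq_nonneg ‖P' (V (Q x))‖, sq_nonneg ‖P (V' (Q' x))‖]
    have hWS : hsInner W S = S.nuclear := by
      rw [hsInner_add_left, hmove hP hQ, hmove hP' hQ', ← hVS]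
      have h1 : P ∘ₗ S ∘ₗ Q = S := by ext x; simp [hPS, hSQ]
      have h2 : P' ∘ₗ S ∘ₗ Q' = 0 := by ext x; simp [hSQ']
      rw [h1, h2]
      simp [hsInner]
    have hWR : hsInner W R = R.nuclear := by
      rw [hsInner_add_left, hmove hP hQ, hmove hP' hQ', ← hVR]
      have h1 : P ∘ₗ R ∘ₗ Q = 0 := by ext x; simp [R, hPP']
      have h2 : P' ∘ₗ R ∘ₗ Q' = R := by ext x; simp [R, hP'P', hQ'Q']
      rw [h1, h2]
      simp [hsInner]
    have h1 : hsInner W (S + T) = hsInner W S + hsInner W R - hsInner (-W) (T - R) := by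
      simp [hsInner, comp_sub, comp_add]
    have h2 := hsInner_le_nuclear hW (S + T)
    have h3 := hsInner_le_nuclear (W := -W) (by simpa using hW) (T - R)
    rw [sub_sub_cancel, ← hWS, ← hWR]
    linarith

end LinearMap

/-! ### Schatten norms of matrices -/

namespace MatrixCompletion

variable {m₁ m₂ : ℕ}

open Module LinearMap

theorem traceInner_eq_sum (A B : Matrix (Fin m₁) (Fin m₂) ℝ) :
    traceInner A B = ∑ j, ∑ k, A j k * B j k := by
  rw [Finset.sum_comm]
  rfl

theorem hsInner_toEuclideanLin (A B : Matrix (Fin m₁) (Fin m₂) ℝ) :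
    hsInner (Matrix.toEuclideanLin A) (Matrix.toEuclideanLin B) = traceInner A B := by
  rw [hsInner_eq_sum (EuclideanSpace.basisFun (Fin m₂) ℝ), traceInner_eq_sum, Finset.sum_comm]
  refine Finset.sum_congr rfl fun k _ => ?_
  simp [PiLp.inner_apply, Matrix.toLpLin_apply, mul_comm]

theorem singularValue_nonneg (A : Matrix (Fin m₁) (Fin m₂) ℝ) (j : ℕ) : 0 ≤ singularValue A j :=
  LinearMap.singularValues_nonneg _ j

theorem opNorm_nonneg (A : Matrix (Fin m₁) (Fin m₂) ℝ) : 0 ≤ opNorm A :=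
  singularValue_nonneg A 0

theorem finrank_range_toEuclideanLin (A : Matrix (Fin m₁) (Fin m₂) ℝ) :
    finrank ℝ (Matrix.toEuclideanLin A).range = A.rank :=
  (A.rank_eq_finrank_range_toLin (PiLp.basisFun 2 ℝ (Fin m₁)) (PiLp.basisFun 2 ℝ (Fin m₂))).symm

/-- The sum over the first `min m₁ m₂` singular values agrees with the sum over the first `m₂`,
their number in Mathlib's indexing by the dimension of the domain, as both contain all that do not
vanish. -/
theorem sum_range_singularValue (A : Matrix (Fin m₁) (Fin m₂) ℝ) {f : ℝ → ℝ} (hf : f 0 = 0) :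
    ∑ j ∈ Finset.range (min m₁ m₂), f (singularValue A j) =
      ∑ i : Fin (finrank ℝ (EuclideanSpace ℝ (Fin m₂))),
        f ((Matrix.toEuclideanLin A).singularValues i) := by
  rw [Fin.sum_univ_eq_sum_range (fun i => f ((Matrix.toEuclideanLin A).singularValues i)),
    finrank_euclideanSpace_fin]
  refine Finset.sum_subset (Finset.range_mono (min_le_right _ _)) fun i _ hi => ?_
  have h : finrank ℝ (Matrix.toEuclideanLin A).range ≤ i := by
    rw [finrank_range_toEuclideanLin]
    rw [Finset.mem_range, not_lt] at hi
    exact (le_min (by simpa using A.rank_le_card_height)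
      (by simpa using A.rank_le_card_width)).trans hi
  rw [singularValue, (Matrix.toEuclideanLin A).singularValues_eq_zero_iff_le_finrank_range.2 h, hf]

theorem schattenNorm_one_eq_nuclear (A : Matrix (Fin m₁) (Fin m₂) ℝ) :
    schattenNorm 1 A = (Matrix.toEuclideanLin A).nuclear := by
  have h := sum_range_singularValue A (f := fun x => x) rfl
  simpa [schattenNorm, nuclear] using h

theorem schattenNorm_two_sq (A : Matrix (Fin m₁) (Fin m₂) ℝ) :
    schattenNorm 2 A ^ 2 = traceInner A A := by
  have h := sum_range_singularValue A (f := (· ^ 2)) (by simp)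
  rw [← hsInner_toEuclideanLin, hsInner_self_eq_sum, ← h, schattenNorm, ← Real.sqrt_eq_rpow]
  rw [Real.sq_sqrt (Finset.sum_nonneg fun j _ => Real.rpow_nonneg (singularValue_nonneg A j) 2)]
  simp

theorem schattenNorm_one_nonneg (A : Matrix (Fin m₁) (Fin m₂) ℝ) : 0 ≤ schattenNorm 1 A := by
  rw [schattenNorm_one_eq_nuclear]
  exact nuclear_nonneg _

/-- Trace duality of the operator and the nuclear norm. -/
theorem traceInner_le_opNorm_mul (A B : Matrix (Fin m₁) (Fin m₂) ℝ) :
    traceInner A B ≤ opNorm A * schattenNorm 1 B := by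
  rw [schattenNorm_one_eq_nuclear, ← hsInner_toEuclideanLin]
  exact hsInner_le_mul_nuclear (norm_apply_le_singularValues_zero _)

theorem schattenNorm_one_add_le (A B : Matrix (Fin m₁) (Fin m₂) ℝ) :
    schattenNorm 1 (A + B) ≤ schattenNorm 1 A + schattenNorm 1 B := by
  simp_rw [schattenNorm_one_eq_nuclear, map_add]
  exact nuclear_add_le _ _

theorem schattenNorm_one_smul_le {c : ℝ} (hc : 0 ≤ c) (A : Matrix (Fin m₁) (Fin m₂) ℝ) :
    schattenNorm 1 (c • A) ≤ c * schattenNorm 1 A := by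
  simp_rw [schattenNorm_one_eq_nuclear, map_smul]
  exact nuclear_smul_le hc _

/-- The matrix form of `LinearMap.exists_nuclear_decomposition`. -/
theorem exists_schattenNorm_one_decomposition (A B : Matrix (Fin m₁) (Fin m₂) ℝ) :
    ∃ D : Matrix (Fin m₁) (Fin m₂) ℝ,
      schattenNorm 1 D ≤ √(2 * A.rank) * √(traceInner B B) ∧
      schattenNorm 1 A + schattenNorm 1 (B - D) ≤ schattenNorm 1 (A + B) + schattenNorm 1 D := by
  obtain ⟨D, h1, h2⟩ :=
    exists_nuclear_decomposition (Matrix.toEuclideanLin A) (Matrix.toEuclideanLin B)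
  refine ⟨Matrix.toEuclideanLin.symm D, ?_, ?_⟩
  · rw [schattenNorm_one_eq_nuclear, LinearEquiv.apply_symm_apply, ← hsInner_toEuclideanLin,
      ← finrank_range_toEuclideanLin]
    exact h1
  · simp_rw [schattenNorm_one_eq_nuclear, map_sub, map_add, LinearEquiv.apply_symm_apply]
    exact h2

/-! ### Means over finite product spaces -/

section ProductMean

variable {α β ι : Type*} [Fintype α] [Fintype β]

/-- The expectation of `F` under the product of `n` copies of the weights `p` on a finite type. -/
def productMean (p : α → ℝ) (n : ℕ) (F : (Fin n → α) → ℝ) : ℝ :=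
  ∑ x, (∏ i, p (x i)) * F x

theorem productMean_zero (p : α → ℝ) (F : (Fin 0 → α) → ℝ) :
    productMean p 0 F = F Fin.elim0 := by
  simp [productMean, Subsingleton.elim (default : Fin 0 → α) Fin.elim0]

theorem productMean_succ (p : α → ℝ) (n : ℕ) (F : (Fin (n + 1) → α) → ℝ) :
    productMean p (n + 1) F =
      ∑ a, p a * productMean p n (fun x => F (Fin.cons a x)) := by
  simp only [productMean]
  rw [← (Fin.consEquiv (fun _ : Fin (n + 1) => α)).sum_comp, Fintype.sum_prod_type]
  refine Finset.sum_congr rfl fun a _ => ?_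
  rw [Finset.mul_sum]
  refine Finset.sum_congr rfl fun x _ => ?_
  simp [Fin.consEquiv, Fin.prod_univ_succ, mul_assoc]

theorem productMean_mono {p : α → ℝ} (hp : ∀ a, 0 ≤ p a) {n : ℕ} {F G : (Fin n → α) → ℝ}
    (h : ∀ x, F x ≤ G x) : productMean p n F ≤ productMean p n G :=
  Finset.sum_le_sum fun x _ =>
    mul_le_mul_of_nonneg_left (h x) (Finset.prod_nonneg fun i _ => hp (x i))

theorem productMean_const_mul (p : α → ℝ) (n : ℕ) (c : ℝ) (F : (Fin n → α) → ℝ) :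
    productMean p n (fun x => c * F x) = c * productMean p n F := by
  simp only [productMean, Finset.mul_sum]
  exact Finset.sum_congr rfl fun x _ => by ring

theorem productMean_add (p : α → ℝ) (n : ℕ) (F G : (Fin n → α) → ℝ) :
    productMean p n (fun x => F x + G x) = productMean p n F + productMean p n G := by
  simp only [productMean, ← Finset.sum_add_distrib, mul_add]

theorem productMean_sub (p : α → ℝ) (n : ℕ) (F G : (Fin n → α) → ℝ) :
    productMean p n (fun x => F x - G x) = productMean p n F - productMean p n G := by
  simp only [productMean, ← Finset.sum_sub_distrib, mul_sub]

theorem productMean_const {p : α → ℝ} (hp : ∑ a, p a = 1) (n : ℕ) (c : ℝ) :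
    productMean p n (fun _ => c) = c := by
  rw [productMean, ← Finset.sum_mul, ← Fintype.sum_pow, hp, one_pow, one_mul]

theorem productMean_comm (p : α → ℝ) (q : β → ℝ) (n m : ℕ)
    (F : (Fin n → α) → (Fin m → β) → ℝ) :
    productMean p n (fun x => productMean q m (F x)) =
      productMean q m (fun y => productMean p n (fun x => F x y)) := by
  simp only [productMean, Finset.mul_sum]
  rw [Finset.sum_comm]
  exact Finset.sum_congr rfl fun _ _ => Finset.sum_congr rfl fun _ _ => by ring

theorem productMean_sum_apply {p : α → ℝ} (hp : ∑ a, p a = 1) (n : ℕ) (g : α → ℝ) :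
    productMean p n (fun x => ∑ i, g (x i)) = n * ∑ a, p a * g a := by
  induction n with
  | zero => simp [productMean_zero]
  | succ n ih =>
    simp only [productMean_succ, Fin.sum_univ_succ, Fin.cons_zero, Fin.cons_succ,
      productMean_add, productMean_const hp, ih, mul_add, Finset.sum_add_distrib, ← Finset.sum_mul,
      hp]
    push_cast
    ring

/-! ### The bounded difference inequality -/

/-- An exponential moment bound for a centred variable with values in an interval of length `c`. -/
theorem sum_mul_exp_sub_mean_le {p : α → ℝ} (hp0 : ∀ a, 0 ≤ p a) (hp : ∑ a, p a = 1)
    {h : α → ℝ} {c : ℝ} (hh : ∀ a b, |h a - h b| ≤ c) :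
    ∑ a, p a * Real.exp (h a - ∑ b, p b * h b) ≤ Real.exp (c ^ 2 / 2) := by
  -- by Jensen, the mean is replaced by an independent copy, which makes the exponent symmetric
  have hJ : Real.exp (-∑ b, p b * h b) ≤ ∑ b, p b * Real.exp (-h b) := by
    have := convexOn_exp.map_sum_le (t := Finset.univ) (w := p) (p := fun b => -h b)
      (fun b _ => hp0 b) hp (fun _ _ => Set.mem_univ _)
    simpa using this
  have hS : ∑ a, ∑ b, p a * p b * Real.exp (h a - h b) =
      ∑ a, ∑ b, p a * p b * Real.cosh (h a - h b) := by
    have hsym : ∑ a, ∑ b, p a * p b * Real.exp (h a - h b) =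
        ∑ a, ∑ b, p a * p b * Real.exp (-(h a - h b)) := by
      rw [Finset.sum_comm]
      refine Finset.sum_congr rfl fun a _ => Finset.sum_congr rfl fun b _ => ?_
      rw [neg_sub, mul_comm (p b)]
    have h2 : ∑ a, ∑ b, p a * p b * Real.cosh (h a - h b) =
        (∑ a, ∑ b, p a * p b * Real.exp (h a - h b) +
          ∑ a, ∑ b, p a * p b * Real.exp (-(h a - h b))) / 2 := by
      simp only [← Finset.sum_add_distrib, Finset.sum_div, Real.cosh_eq]
      exact Finset.sum_congr rfl fun a _ => Finset.sum_congr rfl fun b _ => by ring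
    rw [h2, ← hsym]
    ring
  calc ∑ a, p a * Real.exp (h a - ∑ b, p b * h b)
      = ∑ a, p a * Real.exp (h a) * Real.exp (-∑ b, p b * h b) := by
        refine Finset.sum_congr rfl fun a _ => ?_
        rw [sub_eq_add_neg, Real.exp_add, mul_assoc]
    _ ≤ ∑ a, p a * Real.exp (h a) * ∑ b, p b * Real.exp (-h b) :=
        Finset.sum_le_sum fun a _ =>
          mul_le_mul_of_nonneg_left hJ (mul_nonneg (hp0 a) (Real.exp_pos _).le)
    _ = ∑ a, ∑ b, p a * p b * Real.cosh (h a - h b) := by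
        rw [← hS]
        refine Finset.sum_congr rfl fun a _ => ?_
        rw [Finset.mul_sum]
        refine Finset.sum_congr rfl fun b _ => ?_
        rw [sub_eq_add_neg, Real.exp_add]
        ring
    _ ≤ ∑ a, ∑ b, p a * p b * Real.exp (c ^ 2 / 2) := by
        refine Finset.sum_le_sum fun a _ => Finset.sum_le_sum fun b _ => ?_
        refine mul_le_mul_of_nonneg_left ?_ (mul_nonneg (hp0 a) (hp0 b))
        refine (Real.cosh_le_exp_half_sq _).trans (Real.exp_le_exp.2 ?_)
        have := pow_le_pow_left₀ (abs_nonneg _) (hh a b) 2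
        rw [sq_abs] at this
        linarith
    _ = Real.exp (c ^ 2 / 2) := by
        simp_rw [← Finset.sum_mul, ← Finset.mul_sum, hp, mul_one, hp, one_mul]

/-- The exponential moment bound behind the bounded difference inequality, proved by conditioning on
one coordinate after the other. -/
theorem productMean_exp_sub_mean_le {p : α → ℝ} (hp0 : ∀ a, 0 ≤ p a) (hp : ∑ a, p a = 1)
    {n : ℕ} {F : (Fin n → α) → ℝ} {c : ℝ}
    (hF : ∀ x i a, |F (Function.update x i a) - F x| ≤ c) :
    productMean p n (fun x => Real.exp (F x - productMean p n F)) ≤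
      Real.exp (n * (c ^ 2 / 2)) := by
  induction n with
  | zero => simp [productMean_zero]
  | succ n ih =>
    have hih : ∀ a, productMean p n (fun x => Real.exp (F (Fin.cons a x) -
        productMean p n (fun x => F (Fin.cons a x)))) ≤ Real.exp (n * (c ^ 2 / 2)) := by
      intro a
      refine ih fun x i b => ?_
      rw [Fin.cons_update]
      exact hF _ _ _
    set g : α → ℝ := fun a => productMean p n (fun x => F (Fin.cons a x)) with hg
    -- averaging out all but the first coordinate keeps the bounded difference in that coordinate
    have hgdiff : ∀ a b, g a - g b ≤ c := by
      intro a b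
      rw [hg, ← productMean_sub, ← productMean_const hp n c]
      refine productMean_mono hp0 fun x => ?_
      have := hF (Fin.cons b x) 0 a
      rw [Fin.update_cons_zero] at this
      exact (le_abs_self _).trans this
    have hmean : productMean p (n + 1) F = ∑ a, p a * g a := productMean_succ p n F
    have hstep : ∀ a, productMean p n
        (fun x => Real.exp (F (Fin.cons a x) - productMean p (n + 1) F)) ≤
        Real.exp (g a - ∑ b, p b * g b) * Real.exp (n * (c ^ 2 / 2)) := by
      intro a
      refine le_trans (le_of_eq ?_) (mul_le_mul_of_nonneg_left (hih a) (Real.exp_pos _).le)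
      rw [← productMean_const_mul, hmean]
      congr 1
      funext x
      rw [← Real.exp_add]
      congr 1
      simp only [hg]
      ring
    rw [productMean_succ]
    calc _ ≤ ∑ a, p a * (Real.exp (g a - ∑ b, p b * g b) * Real.exp (n * (c ^ 2 / 2))) :=
          Finset.sum_le_sum fun a _ => mul_le_mul_of_nonneg_left (hstep a) (hp0 a)
      _ = (∑ a, p a * Real.exp (g a - ∑ b, p b * g b)) * Real.exp (n * (c ^ 2 / 2)) := by
          rw [Finset.sum_mul]
          exact Finset.sum_congr rfl fun a _ => by ring
      _ ≤ Real.exp (c ^ 2 / 2) * Real.exp (n * (c ^ 2 / 2)) := by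
          refine mul_le_mul_of_nonneg_right ?_ (Real.exp_pos _).le
          exact sum_mul_exp_sub_mean_le hp0 hp fun a b =>
            abs_le.2 ⟨by linarith [hgdiff b a], hgdiff a b⟩
      _ = _ := by
          rw [← Real.exp_add]
          congr 1
          push_cast
          ring

/-! ### Symmetrization and contraction -/

/-- The value `1` or `-1` of a sign encoded by a Boolean. -/
def sign (b : Bool) : ℝ := if b then 1 else -1

theorem sign_not (b : Bool) : sign (!b) = -sign b := by cases b <;> simp [sign]

theorem abs_sign (b : Bool) : |sign b| = 1 := by cases b <;> simp [sign]

/-- The expectation over `n` independent uniform signs. -/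
noncomputable def signMean (n : ℕ) (F : (Fin n → Bool) → ℝ) : ℝ :=
  productMean (fun _ : Bool => (1 / 2 : ℝ)) n F

theorem signMean_mono {n : ℕ} {F G : (Fin n → Bool) → ℝ} (h : ∀ s, F s ≤ G s) :
    signMean n F ≤ signMean n G :=
  productMean_mono (fun _ => by norm_num) h

theorem signMean_const (n : ℕ) (c : ℝ) : signMean n (fun _ => c) = c :=
  productMean_const (by simp) n c

theorem signMean_comp_not (n : ℕ) (F : (Fin n → Bool) → ℝ) :
    signMean n (fun s => F fun i => !s i) = signMean n F := by
  simp only [signMean, productMean, Finset.prod_const]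
  exact (Equiv.piCongrRight fun _ : Fin n => Equiv.boolNot).sum_comp
    (fun s => (1 / 2 : ℝ) ^ (Finset.univ : Finset (Fin n)).card * F s)

theorem signMean_succ (n : ℕ) (F : (Fin (n + 1) → Bool) → ℝ) :
    signMean (n + 1) F =
      1 / 2 * signMean n (fun s => F (Fin.cons true s) + F (Fin.cons false s)) := by
  simp only [signMean]
  rw [productMean_succ, productMean_add, Fintype.sum_bool]
  ring

/-- Exchanging `x i` and `y i` for some indices `i` leaves the mean over both unchanged. -/
theorem productMean_swap (p : α → ℝ) (n : ℕ) (s : Fin n → Bool)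
    (F : (Fin n → α) → (Fin n → α) → ℝ) :
    productMean p n (fun x => productMean p n (fun y =>
      F (fun i => if s i then x i else y i) (fun i => if s i then y i else x i))) =
    productMean p n (fun x => productMean p n (F x)) := by
  simp only [productMean, Finset.mul_sum]
  rw [← Fintype.sum_prod_type', ← Fintype.sum_prod_type']
  let σ : (Fin n → α) × (Fin n → α) → (Fin n → α) × (Fin n → α) := fun z =>
    (fun i => if s i then z.1 i else z.2 i, fun i => if s i then z.2 i else z.1 i)
  have hσ : Function.Involutive σ := by
    intro z
    ext i <;> by_cases h : s i <;> simp [σ, h]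
  refine Eq.trans ?_ (Equiv.sum_comp hσ.toPerm
    (fun z => (∏ i, p (z.1 i)) * ((∏ i, p (z.2 i)) * F z.1 z.2)))
  refine Finset.sum_congr rfl fun z _ => ?_
  change _ = (∏ i, p ((σ z).1 i)) * ((∏ i, p ((σ z).2 i)) * F (σ z).1 (σ z).2)
  rw [← mul_assoc, ← mul_assoc, ← Finset.prod_mul_distrib, ← Finset.prod_mul_distrib]
  congr 1
  refine Finset.prod_congr rfl fun i _ => ?_
  by_cases h : s i <;> simp [σ, h, mul_comm]

theorem bddAbove_range_sum {n : ℕ} {M : ℝ} {h : Fin n → ι → ℝ} (hM : ∀ i t, |h i t| ≤ M) :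
    BddAbove (Set.range fun t => ∑ i, h i t) := by
  refine ⟨∑ _i : Fin n, M, ?_⟩
  rintro _ ⟨t, rfl⟩
  exact Finset.sum_le_sum fun i _ => (le_abs_self _).trans (hM i t)

variable [Nonempty ι]

/-- Symmetrization: the expected largest deviation of the empirical from the true means is at most
twice the expected supremum of the Rademacher process. -/
theorem productMean_iSup_le_symmetrized {p : α → ℝ} (hp0 : ∀ a, 0 ≤ p a) (hp : ∑ a, p a = 1)
    (n : ℕ) {g : ι → α → ℝ} {M : ℝ} (hg : ∀ t a, |g t a| ≤ M) :
    productMean p n (fun x => ⨆ t, (n * ∑ a, p a * g t a - ∑ i, g t (x i))) ≤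
      2 * productMean p n (fun x => signMean n (fun s => ⨆ t, ∑ i, sign (s i) * g t (x i))) := by
  set D : (Fin n → α) → (Fin n → α) → ℝ := fun x y => ⨆ t, ∑ i, (g t (y i) - g t (x i))
  set A : (Fin n → α) → (Fin n → Bool) → ℝ := fun x s => ⨆ t, ∑ i, sign (s i) * g t (x i)
  have hbA : ∀ (x : Fin n → α) (s : Fin n → Bool),
      BddAbove (Set.range fun t => ∑ i, sign (s i) * g t (x i)) := fun x s =>
    bddAbove_range_sum (M := M) fun i t => by rw [abs_mul, abs_sign, one_mul]; exact hg _ _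
  have hbD : ∀ x y : Fin n → α, BddAbove (Set.range fun t => ∑ i, (g t (y i) - g t (x i))) :=
    fun x y =>
    bddAbove_range_sum (M := M + M) fun i t =>
      (abs_sub _ _).trans (add_le_add (hg _ _) (hg _ _))
  have h1 : ∀ x, ⨆ t, (n * ∑ a, p a * g t a - ∑ i, g t (x i)) ≤ productMean p n (D x) := by
    intro x
    refine ciSup_le fun t => ?_
    rw [← productMean_sum_apply hp n (g t),
      ← productMean_const hp n (∑ i, g t (x i)), ← productMean_sub]
    refine productMean_mono hp0 fun y => ?_
    rw [← Finset.sum_sub_distrib]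
    exact le_ciSup (hbD x y) t
  have h2 : ∀ s, productMean p n (fun x => productMean p n (D x)) ≤
      productMean p n (fun x => A x s) + productMean p n (fun x => A x fun i => !s i) := by
    intro s
    rw [← productMean_swap p n s D]
    have h3 : ∀ x y, D (fun i => if s i then x i else y i) (fun i => if s i then y i else x i) ≤
        A y s + A x fun i => !s i := by
      intro x y
      refine ciSup_le fun t => ?_
      refine le_trans (le_of_eq ?_) (add_le_add (le_ciSup (hbA y s) t)
        (le_ciSup (hbA x fun i => !s i) t))
      rw [← Finset.sum_add_distrib]
      refine Finset.sum_congr rfl fun i _ => ?_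
      rw [sign_not]
      by_cases h : s i <;> simp [h, sign] <;> ring
    refine (productMean_mono hp0 fun x => productMean_mono hp0 fun y => h3 x y).trans ?_
    simp only [productMean_add, productMean_const hp]
    rfl
  refine (productMean_mono hp0 h1).trans ?_
  rw [← signMean_const n (productMean p n fun x => productMean p n (D x))]
  refine (signMean_mono h2).trans ?_
  have h4 := signMean_comp_not n (fun s => productMean p n (fun x => A x s))
  have h5 : productMean p n (fun x => signMean n (A x)) =
      signMean n (fun s => productMean p n (fun x => A x s)) := productMean_comm _ _ _ _ _
  rw [h5, two_mul]
  conv_rhs => enter [2]; rw [← h4]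
  exact (productMean_add _ _ _ _).le

/-- The contraction principle for a single random sign. -/
theorem iSup_add_iSup_le_of_abs_sub_le {f φ ψ : ι → ℝ} (h : ∀ t u, |φ t - φ u| ≤ |ψ t - ψ u|)
    (hb1 : BddAbove (Set.range fun t => f t + ψ t))
    (hb2 : BddAbove (Set.range fun t => f t - ψ t)) :
    (⨆ t, (f t + φ t)) + ⨆ t, (f t - φ t) ≤ (⨆ t, (f t + ψ t)) + ⨆ t, (f t - ψ t) := by
  rw [← le_sub_iff_add_le]
  refine ciSup_le fun t => ?_
  rw [le_sub_comm]
  refine ciSup_le fun u => ?_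
  have h1 := (le_abs_self _).trans (h t u)
  have ht1 := le_ciSup hb1 t
  have ht2 := le_ciSup hb2 t
  have hu1 := le_ciSup hb1 u
  have hu2 := le_ciSup hb2 u
  rcases abs_cases (ψ t - ψ u) with ⟨h2, _⟩ | ⟨h2, _⟩ <;> linarith

/-- The contraction principle for Rademacher processes. The offset `G` collects, in the induction
over the number of signs, the summands that have already been compared. -/
theorem signMean_iSup_le_of_abs_sub_le {n : ℕ} {M K : ℝ} {φ ψ : Fin n → ι → ℝ} {G : ι → ℝ}
    (h : ∀ i t u, |φ i t - φ i u| ≤ |ψ i t - ψ i u|)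
    (hφ : ∀ i t, |φ i t| ≤ M) (hψ : ∀ i t, |ψ i t| ≤ M) (hG : ∀ t, G t ≤ K) :
    signMean n (fun s => ⨆ t, (G t + ∑ i, sign (s i) * φ i t)) ≤
      signMean n (fun s => ⨆ t, (G t + ∑ i, sign (s i) * ψ i t)) := by
  induction n generalizing G K with
  | zero => simp [signMean, productMean_zero]
  | succ n ih =>
    have hψ0 := fun t => abs_le.1 (hψ 0 t)
    have ih1 := ih (φ := fun i => φ i.succ) (ψ := fun i => ψ i.succ) (fun i => h i.succ)
      (fun i => hφ i.succ) (fun i => hψ i.succ) (G := fun t => G t + ψ 0 t) (K := K + M)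
      (fun t => add_le_add (hG t) (hψ0 t).2)
    have ih2 := ih (φ := fun i => φ i.succ) (ψ := fun i => ψ i.succ) (fun i => h i.succ)
      (fun i => hφ i.succ) (fun i => hψ i.succ) (G := fun t => G t - ψ 0 t) (K := K + M)
      (fun t => by linarith [hG t, (hψ0 t).1])
    have hstep : ∀ s : Fin n → Bool,
        (⨆ t, (G t + (φ 0 t + ∑ i : Fin n, sign (s i) * φ i.succ t))) +
          ⨆ t, (G t + (-φ 0 t + ∑ i : Fin n, sign (s i) * φ i.succ t)) ≤
        (⨆ t, (G t + ψ 0 t + ∑ i : Fin n, sign (s i) * φ i.succ t)) +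
          ⨆ t, (G t - ψ 0 t + ∑ i : Fin n, sign (s i) * φ i.succ t) := by
      intro s
      obtain ⟨B, hB⟩ := bddAbove_range_sum (M := M) (h := fun i t => sign (s i) * φ i.succ t)
        (fun i t => by rw [abs_mul, abs_sign, one_mul]; exact hφ _ _)
      have hB' := fun t => hB ⟨t, rfl⟩
      simp only at hB'
      have key := iSup_add_iSup_le_of_abs_sub_le
        (f := fun t => G t + ∑ i : Fin n, sign (s i) * φ i.succ t)
        (h 0) ⟨K + B + M, by
          rintro _ ⟨t, rfl⟩; simp only; linarith [hG t, hB' t, (hψ0 t).2]⟩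
        ⟨K + B + M, by
          rintro _ ⟨t, rfl⟩; simp only; linarith [hG t, hB' t, (hψ0 t).1]⟩
      have e1 : ∀ t, G t + (φ 0 t + ∑ i : Fin n, sign (s i) * φ i.succ t) =
        G t + ∑ i : Fin n, sign (s i) * φ i.succ t + φ 0 t := fun t => by ring
      have e2 : ∀ t, G t + (-φ 0 t + ∑ i : Fin n, sign (s i) * φ i.succ t) =
        G t + ∑ i : Fin n, sign (s i) * φ i.succ t - φ 0 t := fun t => by ring
      have e3 : ∀ t, G t + ψ 0 t + ∑ i : Fin n, sign (s i) * φ i.succ t =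
        G t + ∑ i : Fin n, sign (s i) * φ i.succ t + ψ 0 t := fun t => by ring
      have e4 : ∀ t, G t - ψ 0 t + ∑ i : Fin n, sign (s i) * φ i.succ t =
        G t + ∑ i : Fin n, sign (s i) * φ i.succ t - ψ 0 t := fun t => by ring
      simpa only [e1, e2, e3, e4] using key
    have htrue : sign true = 1 := by simp [sign]
    have hfalse : sign false = -1 := by simp [sign]
    simp only [signMean_succ, Fin.sum_univ_succ, Fin.cons_zero, Fin.cons_succ, htrue, hfalse,
      one_mul, neg_one_mul]
    refine mul_le_mul_of_nonneg_left ((signMean_mono hstep).trans ?_) (by norm_num)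
    simp only [signMean, productMean_add] at ih1 ih2 ⊢
    simpa only [sub_eq_add_neg, add_assoc] using add_le_add ih1 ih2

/-! ### Uniform lower bounds for empirical second moments -/

/-- The mean of the largest deficit of the empirical second moments over a class of functions with
values in `[-1, 1]`, in terms of the Rademacher process of the class itself: the square is
`2`-Lipschitz on `[-1, 1]`. -/
theorem productMean_iSup_sq_le {p : α → ℝ} (hp0 : ∀ a, 0 ≤ p a) (hp : ∑ a, p a = 1)
    (n : ℕ) {f : ι → α → ℝ} (hf : ∀ t a, |f t a| ≤ 1) :
    productMean p n (fun x => ⨆ t, (n * ∑ a, p a * f t a ^ 2 - ∑ i, f t (x i) ^ 2)) ≤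
      4 * productMean p n (fun x => signMean n (fun s => ⨆ t, ∑ i, sign (s i) * f t (x i))) := by
  have hsq : ∀ t a, |f t a ^ 2| ≤ 2 := fun t a => by
    rw [abs_pow]
    exact (pow_le_one₀ (abs_nonneg _) (hf t a)).trans one_le_two
  refine (productMean_iSup_le_symmetrized hp0 hp n (g := fun t a => f t a ^ 2) hsq).trans ?_
  have hx : ∀ x : Fin n → α, signMean n (fun s => ⨆ t, ∑ i, sign (s i) * f t (x i) ^ 2) ≤
      2 * signMean n (fun s => ⨆ t, ∑ i, sign (s i) * f t (x i)) := by
    intro x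
    have hc := signMean_iSup_le_of_abs_sub_le (M := 2) (K := 0) (G := fun _ : ι => 0)
      (φ := fun i t => f t (x i) ^ 2) (ψ := fun i t => 2 * f t (x i))
      (fun i t u => by
        have h1 : f t (x i) ^ 2 - f u (x i) ^ 2 =
            (f t (x i) + f u (x i)) * (f t (x i) - f u (x i)) := by ring
        have h2 : |f t (x i) + f u (x i)| ≤ 2 :=
          (abs_add_le _ _).trans (by linarith [hf t (x i), hf u (x i)])
        rw [h1, ← mul_sub, abs_mul, abs_mul, abs_two]
        exact mul_le_mul_of_nonneg_right h2 (abs_nonneg _))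
      (fun i t => hsq _ _) (fun i t => by rw [abs_mul, abs_two]; linarith [hf t (x i)])
      (fun _ => le_rfl)
    simp only [zero_add] at hc
    refine hc.trans (le_of_eq ?_)
    rw [signMean, signMean, ← productMean_const_mul]
    congr 1
    funext s
    rw [Real.mul_iSup_of_nonneg zero_le_two]
    congr 1
    funext t
    rw [Finset.mul_sum]
    exact Finset.sum_congr rfl fun i _ => by ring
  have := productMean_mono hp0 hx
  rw [productMean_const_mul] at this
  linarith

open Classical in
/-- With probability exponentially close to one, all empirical second moments of a class of
functions with values in `[-1, 1]` exceed the true ones up to a multiple of the Rademacher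
complexity `ρ` and a deviation `u`. -/
theorem productMean_ite_exists_le_exp {p : α → ℝ} (hp0 : ∀ a, 0 ≤ p a) (hp : ∑ a, p a = 1)
    (n : ℕ) {f : ι → α → ℝ} (hf : ∀ t a, |f t a| ≤ 1) {ρ u : ℝ} (hu : 0 ≤ u)
    (hρ : productMean p n (fun x => signMean n (fun s => ⨆ t, ∑ i, sign (s i) * f t (x i))) ≤
      n * ρ) :
    productMean p n (fun x => if ∃ t, ∑ i, f t (x i) ^ 2 <
      n * (∑ a, p a * f t a ^ 2 - 4 * ρ - u) then 1 else 0) ≤ Real.exp (-(n * u ^ 2 / 2)) := by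
  set Z : (Fin n → α) → ℝ := fun x => ⨆ t, (n * ∑ a, p a * f t a ^ 2 - ∑ i, f t (x i) ^ 2)
  have hsq1 : ∀ t a, f t a ^ 2 ≤ 1 := fun t a => by
    rw [← sq_abs]
    exact pow_le_one₀ (abs_nonneg _) (hf t a)
  have hbdd : ∀ x : Fin n → α,
      BddAbove (Set.range fun t => n * ∑ a, p a * f t a ^ 2 - ∑ i, f t (x i) ^ 2) := by
    intro x
    refine ⟨n * ∑ a, p a * 1, ?_⟩
    rintro _ ⟨t, rfl⟩
    have h1 : ∑ a, p a * f t a ^ 2 ≤ ∑ a, p a * 1 :=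
      Finset.sum_le_sum fun a _ => mul_le_mul_of_nonneg_left (hsq1 t a) (hp0 a)
    have h2 : 0 ≤ ∑ i, f t (x i) ^ 2 := Finset.sum_nonneg fun i _ => sq_nonneg _
    have h3 := mul_le_mul_of_nonneg_left h1 (Nat.cast_nonneg (α := ℝ) n)
    simp only
    linarith
  have hmean : productMean p n Z ≤ 4 * (n * ρ) :=
    (productMean_iSup_sq_le hp0 hp n hf).trans (by linarith)
  have hdiff1 : ∀ x i a, Z (Function.update x i a) ≤ Z x + 1 := by
    intro x i a
    refine ciSup_le fun t => ?_
    have h1 := le_ciSup (hbdd x) t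
    have h2 : ∑ j, f t (x j) ^ 2 ≤ ∑ j, f t (Function.update x i a j) ^ 2 + 1 := by
      rw [← Finset.add_sum_erase _ _ (Finset.mem_univ i),
        ← Finset.add_sum_erase _ (fun j => f t (Function.update x i a j) ^ 2) (Finset.mem_univ i)]
      have h3 : ∑ j ∈ Finset.univ.erase i, f t (Function.update x i a j) ^ 2 =
          ∑ j ∈ Finset.univ.erase i, f t (x j) ^ 2 :=
        Finset.sum_congr rfl fun j hj => by
          rw [Function.update_of_ne (Finset.ne_of_mem_erase hj)]
      rw [h3]
      linarith [hsq1 t (x i), sq_nonneg (f t (Function.update x i a i))]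
    linarith
  have hdiff : ∀ x i a, |Z (Function.update x i a) - Z x| ≤ 1 := by
    intro x i a
    have h1 := hdiff1 x i a
    have h2 := hdiff1 (Function.update x i a) i (x i)
    rw [Function.update_idem, Function.update_eq_self] at h2
    exact abs_le.2 ⟨by linarith, by linarith⟩
  have hexp := productMean_exp_sub_mean_le hp0 hp (F := fun x => u * Z x) (c := u) (n := n)
    (fun x i a => by
      rw [← mul_sub, abs_mul, abs_of_nonneg hu]
      exact mul_le_of_le_one_right hu (hdiff x i a))
  rw [productMean_const_mul] at hexp
  calc _ ≤ productMean p n (fun x => Real.exp (-(n * u ^ 2)) *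
          Real.exp (u * Z x - u * productMean p n Z)) := by
        refine productMean_mono hp0 fun x => ?_
        split_ifs with h
        · obtain ⟨t, ht⟩ := h
          rw [← Real.exp_add, Real.one_le_exp_iff]
          have h1 := le_ciSup (hbdd x) t
          have h2 : n * u ≤ Z x - productMean p n Z := by
            change _ ≤ Z x at h1
            linarith
          linarith [mul_le_mul_of_nonneg_left h2 hu]
        · positivity
    _ ≤ Real.exp (-(n * u ^ 2)) * Real.exp (n * (u ^ 2 / 2)) := by
        rw [productMean_const_mul]
        exact mul_le_mul_of_nonneg_left hexp (Real.exp_pos _).le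
    _ = _ := by
        rw [← Real.exp_add]
        congr 1
        ring

end ProductMean

/-! ### The distribution of the sampled entries -/

section Design

variable {m₁ m₂ n : ℕ}

instance : MeasurableSingletonClass (Matrix (Fin m₁) (Fin m₂) ℝ) :=
  inferInstanceAs (MeasurableSingletonClass (Fin m₁ → Fin m₂ → ℝ))

/-- The matrix `e_j e_kᵀ` of the entry `(j, k)`. -/
def unitMatrix (e : Fin m₁ × Fin m₂) : Matrix (Fin m₁) (Fin m₂) ℝ :=
  Matrix.single e.1 e.2 1

theorem unitMatrix_injective :
    Function.Injective (unitMatrix : Fin m₁ × Fin m₂ → Matrix (Fin m₁) (Fin m₂) ℝ) := by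
  rintro ⟨j, k⟩ ⟨j', k'⟩ h
  have := congrFun (congrFun h j) k
  by_contra hne
  rw [unitMatrix, unitMatrix, Matrix.single_apply_same, Matrix.single_apply_of_ne] at this
  · exact one_ne_zero this
  · rintro ⟨h1, h2⟩
    exact hne (by simp_all)

theorem traceInner_unitMatrix (e : Fin m₁ × Fin m₂) (A : Matrix (Fin m₁) (Fin m₂) ℝ) :
    traceInner (unitMatrix e) A = A e.1 e.2 := by
  rw [traceInner_eq_sum]
  simp [unitMatrix, Matrix.single_apply, ite_and]

/-- The sampling distribution as weights on the entries. -/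
noncomputable def entryWeight (Q : Measure (Matrix (Fin m₁) (Fin m₂) ℝ)) (e : Fin m₁ × Fin m₂) :
    ℝ :=
  Q.real {unitMatrix e}

theorem entryWeight_nonneg (Q : Measure (Matrix (Fin m₁) (Fin m₂) ℝ)) (e : Fin m₁ × Fin m₂) :
    0 ≤ entryWeight Q e :=
  measureReal_nonneg

theorem sum_entryWeight {Q : Measure (Matrix (Fin m₁) (Fin m₂) ℝ)} [IsProbabilityMeasure Q]
    (hQ : Q (basisMatrices m₁ m₂)ᶜ = 0) : ∑ e, entryWeight Q e = 1 := by
  have hU : basisMatrices m₁ m₂ = ⋃ e ∈ (Finset.univ : Finset (Fin m₁ × Fin m₂)),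
      {unitMatrix e} := by
    ext B
    simp [basisMatrices, unitMatrix, eq_comm]
  have hB : Q.real (basisMatrices m₁ m₂) = 1 := by
    have hm : MeasurableSet (basisMatrices m₁ m₂) := by
      rw [hU]
      exact Finset.measurableSet_biUnion _ fun e _ => measurableSet_singleton _
    rw [measureReal_def, (prob_compl_eq_zero_iff hm).1 hQ, ENNReal.toReal_one]
  rw [← hB, hU, measureReal_biUnion_finset]
  · rfl
  · intro e _ e' _ hne
    simpa [Function.onFun] using unitMatrix_injective.ne hne
  · exact fun e _ => measurableSet_singleton _

variable {Ω : Type*} {X : Fin n → Ω → Matrix (Fin m₁) (Fin m₂) ℝ}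

/-- The event that the `i`-th sampled entry is `x i`, for all `i`. -/
def sampleEvent (X : Fin n → Ω → Matrix (Fin m₁) (Fin m₂) ℝ) (x : Fin n → Fin m₁ × Fin m₂) :
    Set Ω :=
  ⋂ i, X i ⁻¹' {unitMatrix (x i)}

theorem mem_sampleEvent {x : Fin n → Fin m₁ × Fin m₂} {ω : Ω} :
    ω ∈ sampleEvent X x ↔ ∀ i, X i ω = unitMatrix (x i) := by
  simp [sampleEvent]

theorem eq_of_mem_sampleEvent {x y : Fin n → Fin m₁ × Fin m₂} {ω : Ω} (hx : ω ∈ sampleEvent X x)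
    (hy : ω ∈ sampleEvent X y) : x = y :=
  funext fun i => unitMatrix_injective
    ((mem_sampleEvent.1 hx i).symm.trans (mem_sampleEvent.1 hy i))

variable [MeasurableSpace Ω] {P : Measure Ω} {Q : Measure (Matrix (Fin m₁) (Fin m₂) ℝ)}

theorem measurableSet_sampleEvent (hX : ∀ i, Measurable (X i)) (x : Fin n → Fin m₁ × Fin m₂) :
    MeasurableSet (sampleEvent X x) :=
  MeasurableSet.iInter fun i => hX i (measurableSet_singleton _)

theorem measureReal_sampleEvent (hX : ∀ i, Measurable (X i)) (hind : iIndepFun X P)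
    (hlaw : ∀ i, P.map (X i) = Q) (x : Fin n → Fin m₁ × Fin m₂) :
    P.real (sampleEvent X x) = ∏ i, entryWeight Q (x i) := by
  have h := hind.measure_inter_preimage_eq_mul Finset.univ
    (sets := fun i => {unitMatrix (x i)}) (fun i _ => measurableSet_singleton _)
  simp only [Finset.mem_univ, Set.iInter_true] at h
  rw [measureReal_def, sampleEvent, h, ENNReal.toReal_prod]
  refine Finset.prod_congr rfl fun i _ => ?_
  rw [← Measure.map_apply (hX i) (measurableSet_singleton _), hlaw i]
  rfl

open Classical in
/-- The samples outside a set of bad index vectors form an event of the expected probability. -/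
theorem measureReal_iUnion_sampleEvent [IsProbabilityMeasure P] [IsProbabilityMeasure Q]
    (hQ : Q (basisMatrices m₁ m₂)ᶜ = 0) (hX : ∀ i, Measurable (X i)) (hind : iIndepFun X P)
    (hlaw : ∀ i, P.map (X i) = Q) (bad : (Fin n → Fin m₁ × Fin m₂) → Prop) :
    P.real (⋃ x ∈ Finset.univ.filter (fun x => ¬ bad x), sampleEvent X x) =
      1 - productMean (entryWeight Q) n (fun x => if bad x then 1 else 0) := by
  rw [measureReal_biUnion_finset]
  · simp_rw [measureReal_sampleEvent hX hind hlaw]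
    have h1 := productMean_const (sum_entryWeight hQ) n 1
    rw [eq_sub_iff_add_eq]
    refine Eq.trans ?_ h1
    rw [productMean, productMean, Finset.sum_filter, ← Finset.sum_add_distrib]
    refine Finset.sum_congr rfl fun x _ => ?_
    split_ifs <;> simp_all
  · intro x _ y _ hne
    exact Set.disjoint_left.2 fun ω hx hy => hne (eq_of_mem_sampleEvent hx hy)
  · exact fun x _ => measurableSet_sampleEvent hX x

theorem ae_exists_mem_sampleEvent (hQ : Q (basisMatrices m₁ m₂)ᶜ = 0)
    (hX : ∀ i, Measurable (X i)) (hlaw : ∀ i, P.map (X i) = Q) :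
    ∀ᵐ ω ∂P, ∃ x, ω ∈ sampleEvent X x := by
  have h : ∀ i, ∀ᵐ ω ∂P, ∃ e, X i ω = unitMatrix e := by
    intro i
    have h1 : ∀ᵐ B ∂(P.map (X i)), B ∈ basisMatrices m₁ m₂ := by
      rw [hlaw i]
      exact hQ
    filter_upwards [ae_of_ae_map (hX i).aemeasurable h1] with ω hω
    obtain ⟨j, k, hjk⟩ := hω
    exact ⟨(j, k), hjk⟩
  filter_upwards [ae_all_iff.2 h] with ω hω
  choose x hx using hω
  exact ⟨x, mem_sampleEvent.2 hx⟩

theorem rademacher_real_singleton_sign (b : Bool) : rademacher.real {sign b} = 1 / 2 := by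
  cases b <;> norm_num [rademacher, sign, measureReal_def, Set.indicator]

theorem ae_rademacher : ∀ᵐ w ∂rademacher, ∃ b, w = sign b := by
  have hs : MeasurableSet {w : ℝ | ∃ b, w = sign b} := by
    have : {w : ℝ | ∃ b, w = sign b} = Set.range sign := by ext; simp [Set.range, eq_comm]
    rw [this]
    exact (Set.finite_range sign).measurableSet
  rw [rademacher, ae_add_measure_iff]
  constructor <;> refine Measure.ae_smul_measure ((ae_dirac_iff hs).2 ?_) _
  · exact ⟨true, by simp [sign]⟩
  · exact ⟨false, by simp [sign]⟩

theorem ae_exists_eq_sign :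
    ∀ᵐ w ∂(Measure.pi fun _ : Fin n => rademacher),
      ∃ s : Fin n → Bool, w = fun i => sign (s i) := by
  have h : ∀ i : Fin n, ∀ᵐ w ∂(Measure.pi fun _ : Fin n => rademacher), ∃ b, w i = sign b :=
    fun i => (Measure.quasiMeasurePreserving_eval (fun _ : Fin n => rademacher) i).ae ae_rademacher
  filter_upwards [ae_all_iff.2 h] with w hw
  choose s hs using hw
  exact ⟨s, funext hs⟩

theorem sign_injective : Function.Injective sign := by
  intro a b h
  cases a <;> cases b <;> first | rfl | (norm_num [sign] at h)

/-- The expectation `𝔼 ‖Σ_R‖` as a finite sum over the sampled entries and the signs. -/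
theorem expectedRademacherNorm_eq [IsProbabilityMeasure P] (hQ : Q (basisMatrices m₁ m₂)ᶜ = 0)
    (hX : ∀ i, Measurable (X i)) (hind : iIndepFun X P) (hlaw : ∀ i, P.map (X i) = Q) :
    expectedRademacherNorm P X = productMean (entryWeight Q) n (fun x => signMean n (fun s =>
      opNorm (rademacherMatrix (fun i => sign (s i)) (fun i => unitMatrix (x i))))) := by
  set c : (Fin n → Fin m₁ × Fin m₂) → (Fin n → Bool) → ℝ := fun x s =>
    opNorm (rademacherMatrix (fun i => sign (s i)) (fun i => unitMatrix (x i)))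
  let S : (Fin n → Fin m₁ × Fin m₂) → (Fin n → Bool) → Set (Ω × (Fin n → ℝ)) := fun x s =>
    sampleEvent X x ×ˢ {fun i => sign (s i)}
  have hSm : ∀ x s, MeasurableSet (S x s) := fun x s =>
    (measurableSet_sampleEvent hX x).prod (measurableSet_singleton _)
  have hae : (fun p : Ω × (Fin n → ℝ) => opNorm (rademacherMatrix p.2 (fun i => X i p.1)))
      =ᵐ[P.prod (Measure.pi fun _ : Fin n => rademacher)]
      fun p => ∑ x, ∑ s, (S x s).indicator (fun _ => c x s) p := by
    filter_upwards [Measure.quasiMeasurePreserving_fst.ae (ae_exists_mem_sampleEvent hQ hX hlaw),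
      Measure.quasiMeasurePreserving_snd.ae ae_exists_eq_sign] with p hp hs
    obtain ⟨x, hx⟩ := hp
    obtain ⟨s, hs⟩ := hs
    rw [Finset.sum_eq_single x, Finset.sum_eq_single s]
    · rw [Set.indicator_of_mem (show p ∈ S x s from ⟨hx, hs⟩)]
      simp only [c]
      rw [hs]
      congr
      funext i
      exact mem_sampleEvent.1 hx i
    · intro s' _ hne
      refine Set.indicator_of_notMem (fun h => hne ?_) _
      funext i
      exact sign_injective (congrFun (h.2.symm.trans hs) i)
    · simp
    · intro x' _ hne
      refine Finset.sum_eq_zero fun s' _ => Set.indicator_of_notMem (fun h => hne ?_) _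
      exact eq_of_mem_sampleEvent h.1 hx
    · simp
  rw [expectedRademacherNorm, integral_congr_ae hae, integral_finsetSum _ fun x _ =>
    integrable_finsetSum _ fun s _ => (integrable_const _).indicator (hSm x s)]
  refine Finset.sum_congr rfl fun x _ => ?_
  rw [integral_finsetSum _ fun s _ => (integrable_const _).indicator (hSm x s)]
  simp only [signMean]
  rw [productMean, Finset.mul_sum]
  refine Finset.sum_congr rfl fun s _ => ?_
  rw [integral_indicator_const _ (hSm x s), measureReal_prod_prod,
    measureReal_sampleEvent hX hind hlaw, smul_eq_mul, mul_assoc]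
  congr 2
  rw [measureReal_def, Measure.pi_singleton, ENNReal.toReal_prod]
  exact Finset.prod_congr rfl fun i _ => rademacher_real_singleton_sign (s i)

end Design

/-! ### The basic inequality and the cone condition -/

section Estimator

variable {m₁ m₂ n : ℕ}

theorem abs_apply_le_maxNorm (A : Matrix (Fin m₁) (Fin m₂) ℝ) (j : Fin m₁) (k : Fin m₂) :
    |A j k| ≤ maxNorm A :=
  le_ciSup (f := fun p : Fin m₁ × Fin m₂ => |A p.1 p.2|) (Set.finite_range _).bddAbove (j, k)

theorem traceInner_sub_right (A B C : Matrix (Fin m₁) (Fin m₂) ℝ) :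
    traceInner A (B - C) = traceInner A B - traceInner A C := by
  simp [traceInner, Matrix.mul_sub]

theorem traceInner_smul_sum_left (c : ℝ) (z : Fin n → ℝ) (x : Fin n → Matrix (Fin m₁) (Fin m₂) ℝ)
    (B : Matrix (Fin m₁) (Fin m₂) ℝ) :
    traceInner (c • ∑ i, z i • x i) B = c * ∑ i, z i * traceInner (x i) B := by
  simp [traceInner, Matrix.transpose_sum, Matrix.sum_mul, Matrix.trace_sum]

theorem traceInner_self_nonneg (A : Matrix (Fin m₁) (Fin m₂) ℝ) : 0 ≤ traceInner A A := by
  rw [traceInner_eq_sum]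
  exact Finset.sum_nonneg fun j _ => Finset.sum_nonneg fun k _ => mul_self_nonneg _

/-- The basic inequality of penalized least squares: the estimator does not do worse than `A₀`. -/
theorem mean_sq_traceInner_le {a lam σ : ℝ} {x : Fin n → Matrix (Fin m₁) (Fin m₂) ℝ}
    {z : Fin n → ℝ} {A₀ A' : Matrix (Fin m₁) (Fin m₂) ℝ} (hA₀ : maxNorm A₀ ≤ a)
    (hA' : IsEstimator a lam x (response A₀ σ x z) A') :
    1 / (n : ℝ) * ∑ i, traceInner (x i) (A' - A₀) ^ 2 ≤
      2 * traceInner (noiseMatrix σ z x) (A' - A₀) +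
        lam * (schattenNorm 1 A₀ - schattenNorm 1 A') := by
  have h := hA'.2 A₀ hA₀
  simp only [criterion, response] at h
  have h1 : ∑ i, (traceInner (x i) A₀ + σ * z i - traceInner (x i) A') ^ 2 =
      ∑ i, traceInner (x i) (A' - A₀) ^ 2 -
        2 * σ * ∑ i, z i * traceInner (x i) (A' - A₀) + ∑ i, (σ * z i) ^ 2 := by
    rw [Finset.mul_sum, ← Finset.sum_sub_distrib, ← Finset.sum_add_distrib]
    refine Finset.sum_congr rfl fun i _ => ?_
    rw [traceInner_sub_right]
    ring
  have h2 : ∑ i, (traceInner (x i) A₀ + σ * z i - traceInner (x i) A₀) ^ 2 =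
      ∑ i, (σ * z i) ^ 2 := by simp
  rw [h1, h2] at h
  rw [noiseMatrix, traceInner_smul_sum_left]
  have h3 : 2 * (σ / (n : ℝ) * ∑ i, z i * traceInner (x i) (A' - A₀)) =
      1 / (n : ℝ) * (2 * σ * ∑ i, z i * traceInner (x i) (A' - A₀)) := by ring
  rw [h3]
  linarith

/-- If the penalty dominates the noise, the error of the estimator lies in the cone of matrices
whose nuclear norm is at most a multiple of their Frobenius norm, and its squared prediction error is at
most linear in that norm. -/
theorem estimator_error_bounds {a lam σ : ℝ} {x : Fin n → Matrix (Fin m₁) (Fin m₂) ℝ}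
    {z : Fin n → ℝ} {A₀ A' : Matrix (Fin m₁) (Fin m₂) ℝ} (hA₀ : maxNorm A₀ ≤ a)
    (hlam : 3 * opNorm (noiseMatrix σ z x) < lam)
    (hA' : IsEstimator a lam x (response A₀ σ x z) A') :
    1 / (n : ℝ) * ∑ i, traceInner (x i) (A' - A₀) ^ 2 ≤
        5 / 3 * lam * (√(2 * A₀.rank) * √(traceInner (A' - A₀) (A' - A₀))) ∧
      schattenNorm 1 (A' - A₀) ≤ 6 * (√(2 * A₀.rank) * √(traceInner (A' - A₀) (A' - A₀))) := by
  obtain ⟨D, hD, hdec⟩ := exists_schattenNorm_one_decomposition A₀ (A' - A₀)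
  rw [add_sub_cancel] at hdec
  have hop := opNorm_nonneg (noiseMatrix σ z x)
  have hlam0 : 0 < lam := by linarith
  have hbasic := mean_sq_traceInner_le hA₀ hA'
  have hdual := traceInner_le_opNorm_mul (noiseMatrix σ z x) (A' - A₀)
  have htri := schattenNorm_one_add_le D (A' - A₀ - D)
  rw [add_sub_cancel] at htri
  have hN := schattenNorm_one_nonneg (A' - A₀)
  have hD0 := schattenNorm_one_nonneg D
  have hR0 := schattenNorm_one_nonneg (A' - A₀ - D)
  have h1 : opNorm (noiseMatrix σ z x) * schattenNorm 1 (A' - A₀) ≤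
      lam / 3 * (schattenNorm 1 D + schattenNorm 1 (A' - A₀ - D)) :=
    mul_le_mul (by linarith) htri hN (by linarith)
  have h2 : lam * (schattenNorm 1 A₀ - schattenNorm 1 A') ≤
      lam * (schattenNorm 1 D - schattenNorm 1 (A' - A₀ - D)) :=
    mul_le_mul_of_nonneg_left (by linarith) hlam0.le
  have h3 : 1 / (n : ℝ) * ∑ i, traceInner (x i) (A' - A₀) ^ 2 ≤
      lam / 3 * (5 * schattenNorm 1 D - schattenNorm 1 (A' - A₀ - D)) := by linarith
  constructor
  · have h4 := mul_le_mul_of_nonneg_left hD hlam0.le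
    have h5 := mul_nonneg hlam0.le hR0
    linarith
  · have h4 : 0 ≤ 1 / (n : ℝ) * ∑ i, traceInner (x i) (A' - A₀) ^ 2 := by positivity
    have h5 : 0 ≤ 5 * schattenNorm 1 D - schattenNorm 1 (A' - A₀ - D) :=
      nonneg_of_mul_nonneg_right (h4.trans h3) (by positivity)
    linarith

/-! ### Restricted strong convexity -/

/-- The squared `L₂(Π)`-norm of a matrix, with `Π` given by weights on the entries. -/
def weightedSq (w : Fin m₁ × Fin m₂ → ℝ) (B : Matrix (Fin m₁) (Fin m₂) ℝ) : ℝ :=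
  ∑ e, w e * B e.1 e.2 ^ 2

/-- The matrices with entries in `[-1, 1]`, squared `L₂(Π)`-norm `ν` and nuclear norm at
most `κ`. -/
def normalizedCone (w : Fin m₁ × Fin m₂ → ℝ) (ν κ : ℝ) : Set (Matrix (Fin m₁) (Fin m₂) ℝ) :=
  {B | (∀ e : Fin m₁ × Fin m₂, |B e.1 e.2| ≤ 1) ∧ weightedSq w B = ν ∧ schattenNorm 1 B ≤ κ}

open Classical in
/-- The empirical second moments of the matrices in `normalizedCone w ν κ` are all at least half of
the true one, up to an exponentially small probability, once `κ 𝔼 ‖Σ_R‖` is small compared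
to `ν`. -/
theorem productMean_normalizedCone_le {w : Fin m₁ × Fin m₂ → ℝ} (hw0 : ∀ e, 0 ≤ w e)
    (hw : ∑ e, w e = 1) (hn : 0 < n) {ν κ R : ℝ} (hν : 0 ≤ ν)
    (hR : productMean w n (fun x => signMean n (fun s =>
      opNorm (rademacherMatrix (fun i => sign (s i)) (fun i => unitMatrix (x i))))) = R)
    (hκ : 16 * (κ * R) ≤ ν) :
    productMean w n (fun x => if ∃ B ∈ normalizedCone w ν κ,
      ∑ i, B (x i).1 (x i).2 ^ 2 < n * (ν / 2) then 1 else 0) ≤ Real.exp (-(n * ν ^ 2 / 32)) := by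
  rcases (normalizedCone w ν κ).eq_empty_or_nonempty with hK | hK
  · simp only [hK, Set.mem_empty_iff_false, false_and, exists_false, if_false]
    rw [productMean_const hw]
    positivity
  have : Nonempty (normalizedCone w ν κ) := hK.to_subtype
  have hn' : (0 : ℝ) < n := Nat.cast_pos.2 hn
  have hpoint : ∀ (x : Fin n → Fin m₁ × Fin m₂) (s : Fin n → Bool),
      (⨆ B : normalizedCone w ν κ, ∑ i, sign (s i) * B.1 (x i).1 (x i).2) ≤
      n * κ * opNorm (rademacherMatrix (fun i => sign (s i)) (fun i => unitMatrix (x i))) := by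
    intro x s
    refine ciSup_le fun B => ?_
    have h1 := traceInner_le_opNorm_mul
      (rademacherMatrix (fun i => sign (s i)) (fun i => unitMatrix (x i))) B.1
    have h2 : traceInner (rademacherMatrix (fun i => sign (s i)) (fun i => unitMatrix (x i))) B.1 =
        1 / (n : ℝ) * ∑ i, sign (s i) * B.1 (x i).1 (x i).2 := by
      rw [rademacherMatrix, traceInner_smul_sum_left]
      simp only [traceInner_unitMatrix]
    rw [h2] at h1
    have h3 := mul_le_mul_of_nonneg_left B.2.2.2
      (opNorm_nonneg (rademacherMatrix (fun i => sign (s i)) (fun i => unitMatrix (x i))))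
    have h4 := mul_le_mul_of_nonneg_left (h1.trans h3) hn'.le
    rw [← mul_assoc, mul_one_div_cancel hn'.ne', one_mul] at h4
    linarith
  have hρ : productMean w n (fun x => signMean n (fun s =>
      ⨆ B : normalizedCone w ν κ, ∑ i, sign (s i) * B.1 (x i).1 (x i).2)) ≤ n * (κ * R) := by
    refine (productMean_mono hw0 fun x => signMean_mono (hpoint x)).trans (le_of_eq ?_)
    rw [← hR, ← mul_assoc, ← productMean_const_mul]
    congr 1
    funext x
    exact productMean_const_mul _ _ _ _
  have hmain := productMean_ite_exists_le_exp hw0 hw n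
    (f := fun (B : normalizedCone w ν κ) e => B.1 e.1 e.2) (fun B e => B.2.1 e)
    (u := ν / 4) (by positivity) hρ
  refine le_trans (productMean_mono hw0 fun x => ?_) (hmain.trans (le_of_eq ?_))
  · by_cases hx : ∃ B ∈ normalizedCone w ν κ, ∑ i, B (x i).1 (x i).2 ^ 2 < n * (ν / 2)
    · rw [if_pos hx, if_pos]
      obtain ⟨B, hB, hlt⟩ := hx
      refine ⟨⟨B, hB⟩, hlt.trans_le (mul_le_mul_of_nonneg_left ?_ hn'.le)⟩
      have := hB.2.1
      rw [weightedSq] at this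
      simp only [this]
      linarith
    · rw [if_neg hx]
      split_ifs <;> norm_num
  · congr 1
    ring

/-- Restricted strong convexity extends from the normalized matrices to all large ones by
homogeneity. -/
theorem half_weightedSq_le {w : Fin m₁ × Fin m₂ → ℝ} (hn : 0 < n) {ν κ a S M : ℝ}
    (hν : 0 < ν) (hS : 0 ≤ S) (hκ : κ = 6 * (S * √(M * ν)))
    {x : Fin n → Fin m₁ × Fin m₂}
    (hx : ∀ B ∈ normalizedCone w ν κ, n * (ν / 2) ≤ ∑ i, B (x i).1 (x i).2 ^ 2)
    {Δ : Matrix (Fin m₁) (Fin m₂) ℝ} (hΔ : ∀ e : Fin m₁ × Fin m₂, |Δ e.1 e.2| ≤ 2 * a)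
    (hcone : schattenNorm 1 Δ ≤ 6 * (S * √(traceInner Δ Δ)))
    (hlow : traceInner Δ Δ ≤ M * weightedSq w Δ) (hbig : 4 * a ^ 2 * ν < weightedSq w Δ) :
    weightedSq w Δ / 2 ≤ 1 / (n : ℝ) * ∑ i, Δ (x i).1 (x i).2 ^ 2 := by
  have hn' : (0 : ℝ) < n := Nat.cast_pos.2 hn
  have hW : 0 < weightedSq w Δ := lt_of_le_of_lt (by positivity) hbig
  set t := √(ν / weightedSq w Δ) with ht
  have ht0 : 0 < t := Real.sqrt_pos.2 (by positivity)
  have ht2 : t ^ 2 = ν / weightedSq w Δ := Real.sq_sqrt (by positivity)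
  have hB : t • Δ ∈ normalizedCone w ν κ := by
    refine ⟨fun e => ?_, ?_, ?_⟩
    · rw [Matrix.smul_apply, smul_eq_mul, abs_mul, abs_of_pos ht0]
      have h1 : t * |Δ e.1 e.2| ≤ t * (2 * a) := mul_le_mul_of_nonneg_left (hΔ e) ht0.le
      have h2 : (t * (2 * a)) ^ 2 ≤ 1 ^ 2 := by
        rw [mul_pow, ht2, div_mul_eq_mul_div, one_pow, div_le_one hW]
        linarith
      exact h1.trans (le_of_sq_le_sq h2 zero_le_one)
    · have : weightedSq w (t • Δ) = t ^ 2 * weightedSq w Δ := by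
        rw [weightedSq, weightedSq, Finset.mul_sum]
        refine Finset.sum_congr rfl fun e _ => ?_
        rw [Matrix.smul_apply, smul_eq_mul]
        ring
      rw [this, ht2, div_mul_cancel₀ _ hW.ne']
    · refine (schattenNorm_one_smul_le ht0.le Δ).trans ?_
      have h1 : t * √(traceInner Δ Δ) ≤ √(M * ν) := by
        rw [ht, ← Real.sqrt_mul (by positivity)]
        refine Real.sqrt_le_sqrt ?_
        rw [div_mul_eq_mul_div, div_le_iff₀ hW]
        linarith [mul_le_mul_of_nonneg_left hlow hν.le]
      have h2 := mul_le_mul_of_nonneg_left hcone ht0.le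
      have h3 := mul_le_mul_of_nonneg_left h1 hS
      rw [hκ]
      linarith
  have h := hx _ hB
  have h1 : ∑ i, (t • Δ) (x i).1 (x i).2 ^ 2 = t ^ 2 * ∑ i, Δ (x i).1 (x i).2 ^ 2 := by
    rw [Finset.mul_sum]
    refine Finset.sum_congr rfl fun i _ => ?_
    rw [Matrix.smul_apply, smul_eq_mul]
    ring
  rw [h1, ht2, div_mul_eq_mul_div, le_div_iff₀ hW] at h
  rw [one_div, inv_mul_eq_div, le_div_iff₀ hn']
  refine le_of_mul_le_mul_left ?_ hν
  linarith

theorem traceInner_self_le_mul_weightedSq {w : Fin m₁ × Fin m₂ → ℝ} {M : ℝ} (hM : 0 < M)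
    (hw : ∀ e, M⁻¹ ≤ w e) (B : Matrix (Fin m₁) (Fin m₂) ℝ) :
    traceInner B B ≤ M * weightedSq w B := by
  rw [traceInner_eq_sum, ← Fintype.sum_prod_type', weightedSq, Finset.mul_sum]
  refine Finset.sum_le_sum fun e _ => ?_
  have h := mul_le_mul_of_nonneg_left (hw e) hM.le
  rw [mul_inv_cancel₀ hM.ne'] at h
  nlinarith [sq_nonneg (B e.1 e.2)]

theorem exp_neg_le_of_log_le {d n : ℕ} (hd : 0 < d) (hn : 0 < n) {ν : ℝ}
    (hν : 6 * √(Real.log d / n) ≤ ν) : Real.exp (-(n * ν ^ 2 / 32)) ≤ 2 / (d : ℝ) := by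
  have hd' : (0 : ℝ) < d := Nat.cast_pos.2 hd
  have hn' : (0 : ℝ) < n := Nat.cast_pos.2 hn
  have hlog : 0 ≤ Real.log d := Real.log_natCast_nonneg d
  have h1 := pow_le_pow_left₀ (by positivity) hν 2
  rw [mul_pow, Real.sq_sqrt (by positivity)] at h1
  have h2 := mul_le_mul_of_nonneg_left h1 hn'.le
  have h3 : (n : ℝ) * (6 ^ 2 * (Real.log d / n)) = 36 * Real.log d := by
    field_simp
    ring
  calc Real.exp (-(n * ν ^ 2 / 32)) ≤ Real.exp (-Real.log d) :=
        Real.exp_le_exp.2 (by linarith)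
    _ = 1 / (d : ℝ) := by rw [Real.exp_neg, Real.exp_log hd', one_div]
    _ ≤ 2 / (d : ℝ) := by gcongr; norm_num

end Estimator

end MatrixCompletion

/-! ### The error bound -/

open MatrixCompletion in
theorem theorem3 :
    ∃ c₁ c₂ : ℝ, 0 < c₁ ∧ 0 < c₂ ∧
      ∀ (m₁ m₂ n : ℕ) (_hn : 0 < n)
        (Ω : Type*) [MeasurableSpace Ω] (P : Measure Ω) [IsProbabilityMeasure P]
        -- the sampling distribution, concentrated on the matrices `e_j e_kᵀ`
        (Q : Measure (Matrix (Fin m₁) (Fin m₂) ℝ)) [IsProbabilityMeasure Q]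
        (_hQ : Q (basisMatrices m₁ m₂)ᶜ = 0)
        (L μ : ℝ) (_hL : MarginalBound Q L) (_hμ : EntryLowerBound Q μ)
        -- the i.i.d. design
        (X : Fin n → Ω → Matrix (Fin m₁) (Fin m₂) ℝ) (_hX : ∀ i, Measurable (X i))
        (_hXindep : iIndepFun X P) (_hXlaw : ∀ i, P.map (X i) = Q)
        -- the noise
        (ξ : Fin n → Ω → ℝ) (_hξ : ∀ i, Measurable (ξ i)) (_hξindep : iIndepFun ξ P)
        (_hξmean : ∀ i, ∫ ω, ξ i ω ∂P = 0) (_hξvar : ∀ i, ∫ ω, ξ i ω ^ 2 ∂P = 1)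
        (σ a : ℝ) (A₀ : Matrix (Fin m₁) (Fin m₂) ℝ) (_hA₀ : maxNorm A₀ ≤ a),
        ∃ E : Set Ω, MeasurableSet E ∧ 1 - 2 / ((m₁ + m₂ : ℕ) : ℝ) ≤ P.real E ∧
          ∀ ω ∈ E, ∀ lam : ℝ,
            3 * opNorm (noiseMatrix σ (fun i => ξ i ω) (fun i => X i ω)) < lam →
            ∀ A' : Matrix (Fin m₁) (Fin m₂) ℝ,
              IsEstimator a lam (fun i => X i ω)
                (response A₀ σ (fun i => X i ω) (fun i => ξ i ω)) A' →
              schattenNorm 2 (A' - A₀) ^ 2 / (m₁ * m₂) ≤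
                max
                  (c₁ * μ ^ 2 * (m₁ * m₂) * A₀.rank *
                    (lam ^ 2 + a ^ 2 * expectedRademacherNorm P X ^ 2))
                  (c₂ * a ^ 2 * μ * √(Real.log ((m₁ + m₂ : ℕ) : ℝ) / n)) := by
  classical
  refine ⟨73728, 24, by norm_num, by norm_num, ?_⟩
  intro m₁ m₂ n hn Ω _ P _ Q _ hQ L μ _ hμ X hX hind hlaw ξ _ _ _ _ σ a A₀ hA₀
  have hw0 := entryWeight_nonneg Q
  have hw := sum_entryWeight hQ
  set w := entryWeight Q
  obtain ⟨e₀⟩ : Nonempty (Fin m₁ × Fin m₂) := by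
    by_contra h
    rw [not_nonempty_iff] at h
    simp at hw
  have hm₁ : 0 < m₁ := e₀.1.pos
  have hm₂ : 0 < m₂ := e₀.2.pos
  have hm₁' : (0 : ℝ) < m₁ := Nat.cast_pos.2 hm₁
  have hm₂' : (0 : ℝ) < m₂ := Nat.cast_pos.2 hm₂
  have hn' : (0 : ℝ) < n := Nat.cast_pos.2 hn
  have hμ0 : 0 < μ := lt_of_lt_of_le one_pos hμ.1
  set R := expectedRademacherNorm P X
  have hReq := expectedRademacherNorm_eq hQ hX hind hlaw
  set M := μ * m₁ * m₂ with hM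
  have hM0 : 0 < M := by positivity
  set r : ℝ := (A₀.rank : ℝ)
  have hr0 : 0 ≤ r := Nat.cast_nonneg _
  set ℓ := √(Real.log ((m₁ + m₂ : ℕ) : ℝ) / n)
  -- From the level `6 * ℓ` on deviations are improbable; `18432 = 2 * (16 * 6) ^ 2` is what the bound
  -- `16 * (κ * R) ≤ ν` on the Rademacher complexity requires, for the `κ` below. The constants of the
  -- claim are four times `6` and `18432`, as the threshold for the error is `4 * a ^ 2 * ν`.
  set ν := max (6 * ℓ) (18432 * r * M * R ^ 2) with hν
  have hν0 : 0 < ν := by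
    refine lt_max_of_lt_left (mul_pos (by norm_num) (Real.sqrt_pos.2 (div_pos ?_ hn')))
    exact Real.log_pos (by exact_mod_cast (by omega : 1 < m₁ + m₂))
  set κ := 6 * (√(2 * r) * √(M * ν)) with hκ
  have hκR : 16 * (κ * R) ≤ ν := by
    have h1 : (16 * (κ * R)) ^ 2 ≤ ν ^ 2 := by
      have h2 : (16 * (κ * R)) ^ 2 = (18432 * r * M * R ^ 2) * ν := by
        rw [hκ]
        simp only [mul_pow]
        rw [Real.sq_sqrt (by positivity), Real.sq_sqrt (by positivity)]
        ring
      rw [h2, sq ν]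
      exact mul_le_mul_of_nonneg_right (le_max_right _ _) hν0.le
    exact le_of_sq_le_sq h1 hν0.le
  let bad : (Fin n → Fin m₁ × Fin m₂) → Prop := fun x =>
    ∃ B ∈ normalizedCone w ν κ, ∑ i, B (x i).1 (x i).2 ^ 2 < n * (ν / 2)
  refine ⟨⋃ x ∈ Finset.univ.filter (fun x => ¬ bad x), sampleEvent X x, ?_, ?_, ?_⟩
  · exact Finset.measurableSet_biUnion _ fun x _ => measurableSet_sampleEvent hX x
  · rw [measureReal_iUnion_sampleEvent hQ hX hind hlaw bad]
    have h1 := productMean_normalizedCone_le hw0 hw hn hν0.le hReq.symm hκR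
    have h2 := exp_neg_le_of_log_le (d := m₁ + m₂) (by omega) hn (le_max_left _ _ : 6 * ℓ ≤ ν)
    have h3 := h1.trans h2
    simp only [bad]
    linarith
  intro ω hω lam hlam A' hA'
  obtain ⟨x, hx, hωx⟩ := Set.mem_iUnion₂.1 hω
  have hgood : ∀ B ∈ normalizedCone w ν κ, n * (ν / 2) ≤ ∑ i, B (x i).1 (x i).2 ^ 2 := by
    intro B hB
    by_contra! h
    exact (Finset.mem_filter.1 hx).2 ⟨B, hB, h⟩
  have hXω : ∀ i, X i ω = unitMatrix (x i) := mem_sampleEvent.1 hωx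
  obtain ⟨hpred, hcone⟩ := estimator_error_bounds hA₀ hlam hA'
  simp only [hXω, traceInner_unitMatrix] at hpred
  have hΔ : ∀ e : Fin m₁ × Fin m₂, |(A' - A₀) e.1 e.2| ≤ 2 * a := by
    intro e
    have h1 := (abs_apply_le_maxNorm A' e.1 e.2).trans hA'.1
    have h2 := (abs_apply_le_maxNorm A₀ e.1 e.2).trans hA₀
    exact (abs_sub _ _).trans (by linarith)
  set Δ := A' - A₀
  have hlow : traceInner Δ Δ ≤ M * weightedSq w Δ :=
    traceInner_self_le_mul_weightedSq hM0 (fun e => hμ.2 e.1 e.2) Δ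
  rw [schattenNorm_two_sq, div_le_iff₀ (by positivity)]
  rcases le_or_gt (weightedSq w Δ) (4 * a ^ 2 * ν) with hsmall | hbig
  · have h1 : traceInner Δ Δ ≤ 4 * a ^ 2 * μ * ν * (m₁ * m₂) := by
      have := mul_le_mul_of_nonneg_left hsmall hM0.le
      rw [hM] at this hlow
      linarith
    refine h1.trans (mul_le_mul_of_nonneg_right ?_ (by positivity))
    rw [hν, mul_max_of_nonneg _ _ (by positivity), max_comm]
    refine max_le_max ?_ (le_of_eq (by ring))
    have h2 : 4 * a ^ 2 * μ * (18432 * r * M * R ^ 2) =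
        73728 * μ ^ 2 * (m₁ * m₂) * r * (a ^ 2 * R ^ 2) := by
      rw [hM]; ring
    rw [h2]
    exact mul_le_mul_of_nonneg_left (by linarith [sq_nonneg lam]) (by positivity)
  · have hrsc := (half_weightedSq_le hn hν0 (Real.sqrt_nonneg _) hκ hgood hΔ hcone hlow
      hbig).trans hpred
    set F := √(traceInner Δ Δ)
    have hFsq : F ^ 2 = traceInner Δ Δ := Real.sq_sqrt (traceInner_self_nonneg Δ)
    have hF0 : 0 ≤ F := Real.sqrt_nonneg _
    have hop := opNorm_nonneg (noiseMatrix σ (fun i => ξ i ω) fun i => X i ω)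
    have hlam0 : 0 ≤ lam := by linarith
    have h1 : F * F ≤ 10 / 3 * M * lam * √(2 * r) * F := by
      have := mul_le_mul_of_nonneg_left hrsc hM0.le
      rw [← sq, hFsq]
      linarith
    have h2 : F ≤ 10 / 3 * M * lam * √(2 * r) := by
      rcases hF0.eq_or_lt with h | h
      · rw [← h]; positivity
      · exact le_of_mul_le_mul_right h1 h
    have h3 := pow_le_pow_left₀ hF0 h2 2
    rw [hFsq, mul_pow, Real.sq_sqrt (by positivity)] at h3
    have h4 : (10 / 3 * M * lam) ^ 2 * (2 * r) =
        200 / 9 * μ ^ 2 * (m₁ * m₂) * r * lam ^ 2 * (m₁ * m₂) := by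
      rw [hM]; ring
    rw [h4] at h3
    refine h3.trans (mul_le_mul_of_nonneg_right (le_max_of_le_left ?_) (by positivity))
    have h5 : lam ^ 2 ≤ lam ^ 2 + a ^ 2 * R ^ 2 := le_add_of_nonneg_right (by positivity)
    gcongr
    norm_num
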